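/- Let $V=\mathbb{C}^{N+1}$ with the bilinear form $\langle x,y\rangle=\sum_i x_iy_i$ and $q(x)=\langle x,x\rangle$. Let $Z\subset X\subset V$ be irreducible affine varieties; closures are Zariski closures, and irreducible varieties are nonempty and closed. Let $X_{\rm sm}$ and $X_{\rm sing}=X\setminus X_{\rm sm}$ be the smooth and singular loci of $X$, and for $x\in X_{\rm sm}$ let $N_xX=\{y\in V:\langle y,v\rangle=0\text{ for all }v\in T_xX\}$. Define $$\mathcal E_X=\overline{\{(x,u)\in V\times V: x\in X_{\rm sm},\ u-x\in N_xX\}},\qquad \mathcal E_{X|Z}=\overline{\{(x,u)\in V\times V: x\in X_{\rm sm}\cap Z,\ u-x\in N_xX\}},$$ let ${\rm pr}_1,{\rm pr}_2$ be the projections $(x,u)\mapsto x$ and $(x,u)\mapsto u$, and let $\mathrm{DL}_{X|Z}=\overline{{\rm pr}_2(\mathcal E_{X|Z})}\subset V$ be the ED data locus of $X$ given $Z$. (1) Affine case. Say that $X$ is ED regular given $Z$ if $Z\not\subset X_{\rm sing}$ and there is a dense Zariski open set $\mathcal U\subset V$ such that $\mathrm{DL}_{X|Z}\not\subset V\setminus\mathcal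 U$ and, for every $u\in\mathcal U$, the critical locus $\{x:(x,u)\in\mathcal E_X\}$ is finite. If $Z$ has codimension $\delta$ in $X$ and $X$ is ED regular given $Z$, then $\mathrm{DL}_{X|Z}$ is irreducible of codimension $\delta$ in $V$. Moreover, over $X_{\rm sm}\cap Z$ the projection ${\rm pr}_1\colon\mathcal E_{X|Z}\to V$ is a Zariski locally trivial affine bundle of rank $c=\operatorname{codim}_V X$. (2) Projective case. Let in addition $X$ and $Z$ be cones through the origin, with $\dim X=n+1$ and $\dim Z=d+1$ for integers $n,d\ge 0$, and let $Q=\{x\in V:q(x)=0\}$. Let $\mathcal{PE}_X\subset\mathbb P(V)\times V$ be the closure of the image of $\{(x,u)\in\mathcal E_X:x\neq 0\}$ under $(x,u)\mapsto([x],u)$. Say that $X$ is ED regular given $Z$ (in the projective sense) if $Z\not\subset X_{\rm sing}\cup Q$ and $\mathrm{DL}_{X|Z}$ is not contained in the set of all $u\in V$ for which $\{[x]\in\mathbb P(V):([x],u)\in\mathcal{PE}_X\}$ has positive dimension. If this holds, then $\mathrm{DL}_{X|Z}$ is irreducible of dimension $N+1-n+d$. -/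

import Mathlib

noncomputable section

namespace EDData

/-! ### Affine algebraic sets over the complex numbers -/

section Affine

variable {σ : Type*}

/-- `S` is the common zero set of some family of polynomials. -/
def IsZariskiClosed (S : Set (σ → ℂ)) : Prop :=
  ∃ I : Ideal (MvPolynomial σ ℂ), S = MvPolynomial.zeroLocus ℂ I

/-- The Zariski closure: all common zeros of the polynomials vanishing on `S`. -/
def zariskiClosure (S : Set (σ → ℂ)) : Set (σ → ℂ) :=
  MvPolynomial.zeroLocus ℂ (MvPolynomial.vanishingIdeal ℂ S)

theorem isZariskiClosed_zariskiClosure (S : Set (σ → ℂ)) : IsZariskiClosed (zariskiClosure S) :=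
  ⟨_, rfl⟩

theorem subset_zariskiClosure (S : Set (σ → ℂ)) : S ⊆ zariskiClosure S :=
  MvPolynomial.zeroLocus_vanishingIdeal_le S

theorem zariskiClosure_subset {S T : Set (σ → ℂ)} (hT : IsZariskiClosed T) (h : S ⊆ T) :
    zariskiClosure S ⊆ T := by
  obtain ⟨I, rfl⟩ := hT
  exact MvPolynomial.zeroLocus_anti_mono (MvPolynomial.le_zeroLocus_iff_le_vanishingIdeal.1 h)

/-- An irreducible affine variety: a nonempty Zariski closed set that is not the union of two
smaller Zariski closed sets. -/
def IsIrreducibleVariety (S : Set (σ → ℂ)) : Prop :=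
  IsZariskiClosed S ∧ S.Nonempty ∧
    ∀ A B : Set (σ → ℂ), IsZariskiClosed A → IsZariskiClosed B → S = A ∪ B → S = A ∨ S = B

/-- The dimension of an affine variety: the Krull dimension of its coordinate ring. -/
def dim (S : Set (σ → ℂ)) : WithBot ℕ∞ :=
  ringKrullDim (MvPolynomial σ ℂ ⧸ MvPolynomial.vanishingIdeal ℂ S)

variable [Fintype σ]

/-- The tangent space `T_x X` (as a linear subspace): the kernel of the Jacobian matrix at `x`
of generators, equivalently of all elements, of the radical ideal of `X`. -/
def tangentSpace (X : Set (σ → ℂ)) (x : σ → ℂ) : Submodule ℂ (σ → ℂ) where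
  carrier := {v | ∀ f ∈ MvPolynomial.vanishingIdeal ℂ X,
    ∑ i, MvPolynomial.eval x (MvPolynomial.pderiv i f) * v i = 0}
  add_mem' := by
    intro v w hv hw f hf
    simp only [Pi.add_apply, mul_add, Finset.sum_add_distrib, hv f hf, hw f hf, add_zero]
  zero_mem' := by
    intro f _
    simp
  smul_mem' := by
    intro a v hv f hf
    have h := hv f hf
    simp only [Pi.smul_apply, smul_eq_mul, mul_left_comm _ a, ← Finset.mul_sum, h, mul_zero]

/-- The smooth points of an irreducible variety `X`: the points of `X` at which the tangent space
has dimension `dim X`, that is, the Jacobian matrix has rank `codim X`. -/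
def smoothLocus (X : Set (σ → ℂ)) : Set (σ → ℂ) :=
  {x | x ∈ X ∧ (Module.finrank ℂ (tangentSpace X x) : WithBot ℕ∞) = dim X}

/-- The singular points of an irreducible variety. -/
def singularLocus (X : Set (σ → ℂ)) : Set (σ → ℂ) := X \ smoothLocus X

/-- The normal space `N_x X`: the vectors orthogonal to `T_x X` for the complex bilinear form
`⟨y, v⟩ = ∑ i, y i * v i`. -/
def normalSpace (X : Set (σ → ℂ)) (x : σ → ℂ) : Set (σ → ℂ) :=
  {y | ∀ v ∈ tangentSpace X x, ∑ i, y i * v i = 0}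

/-- A point `x` of `X` is critical for the restriction to `X` of the squared distance
`q (u - x) = ∑ i, (u i - x i) ^ 2`: its gradient, a multiple of `u - x`, is normal to `X`. -/
def IsCritical (X : Set (σ → ℂ)) (u x : σ → ℂ) : Prop :=
  u - x ∈ normalSpace X x

/-- The ED correspondence of `X` given `Z`, as a subset of `V_x × V_u`. A pair `(x, u)` is written
as the point `Sum.elim x u` of `ℂ ^ (σ ⊕ σ)`. -/
def condEDCorrespondence (X Z : Set (σ → ℂ)) : Set (σ ⊕ σ → ℂ) :=
  zariskiClosure {p | ∃ x u : σ → ℂ, p = Sum.elim x u ∧ x ∈ smoothLocus X ∩ Z ∧ IsCritical X u x}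

/-- The ED correspondence of `X`, as a subset of `V_x × V_u`. -/
def edCorrespondence (X : Set (σ → ℂ)) : Set (σ ⊕ σ → ℂ) :=
  zariskiClosure {p | ∃ x u : σ → ℂ, p = Sum.elim x u ∧ x ∈ smoothLocus X ∧ IsCritical X u x}

/-- The critical locus of the squared distance from `u` on `X`: the first projection of the fibre
over `u` of the ED correspondence. -/
def critLocus (X : Set (σ → ℂ)) (u : σ → ℂ) : Set (σ → ℂ) :=
  {x | Sum.elim x u ∈ edCorrespondence X}

/-- The ED data locus of `X` given `Z`: the Zariski closure of the second projection of the
conditional ED correspondence. -/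
def dataLocus (X Z : Set (σ → ℂ)) : Set (σ → ℂ) :=
  zariskiClosure {u | ∃ x : σ → ℂ, Sum.elim x u ∈ condEDCorrespondence X Z}

/-- `X` is ED regular given `Z` (affine varieties): `Z` is not contained in the singular locus
of `X`, and the data locus is not contained in the complement of a dense open set `U` of data
points whose critical locus is zero-dimensional, i.e. finite. -/
def IsEDRegular (X Z : Set (σ → ℂ)) : Prop :=
  ¬ Z ⊆ singularLocus X ∧
    ∃ U : Set (σ → ℂ), IsZariskiClosed Uᶜ ∧ zariskiClosure U = Set.univ ∧
      (∀ u ∈ U, (critLocus X u).Finite) ∧ ¬ dataLocus X Z ⊆ Uᶜ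

/-- Over the set `B`, the first projection makes `E` (a subset of `V_x × V_u`) an affine bundle
of rank `r`, locally trivial for the Zariski topology: near every point of `B` there are regular
functions `a / h` and `g 1, …, g r` with values in `V_u` such that the fibre of `E` over `x` is
`a x / h x + span (g 1 x, …, g r x)`, with `g 1 x, …, g r x` linearly independent. -/
def IsAffineBundleOver (B : Set (σ → ℂ)) (E : Set (σ ⊕ σ → ℂ)) (r : ℕ) : Prop :=
  ∀ z ∈ B, ∃ (h : MvPolynomial σ ℂ) (a : σ → MvPolynomial σ ℂ)
    (g : Fin r → σ → MvPolynomial σ ℂ), MvPolynomial.eval z h ≠ 0 ∧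
    ∀ x ∈ B, MvPolynomial.eval x h ≠ 0 →
      LinearIndependent ℂ (fun (j : Fin r) (i : σ) => MvPolynomial.eval x (g j i)) ∧
      ∀ u : σ → ℂ, Sum.elim x u ∈ E ↔
        u - (fun i => MvPolynomial.eval x (a i) / MvPolynomial.eval x h) ∈
          Submodule.span ℂ (Set.range fun (j : Fin r) (i : σ) => MvPolynomial.eval x (g j i))

end Affine

/-! ### Affine cones and the projective ED correspondence -/

section Projective

variable {σ : Type*}

/-- `S` is a cone through the origin. -/
def IsCone (S : Set (σ → ℂ)) : Prop := ∀ x ∈ S, ∀ a : ℂ, a • x ∈ S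

/-- Zariski closed subsets of `ℙ(V_x) × V_u`: the zero sets of families of polynomials in `(x, u)`
that are homogeneous in `x`. -/
def IsProjZariskiClosed (C : Set (Projectivization ℂ (σ → ℂ) × (σ → ℂ))) : Prop :=
  ∃ F : Set (MvPolynomial (σ ⊕ σ) ℂ),
    (∀ f ∈ F, ∃ k : ℕ,
      MvPolynomial.IsWeightedHomogeneous (Sum.elim (fun _ => 1) (fun _ => 0) : σ ⊕ σ → ℕ) f k) ∧
    C = {p | ∀ f ∈ F, MvPolynomial.eval (Sum.elim p.1.rep p.2) f = 0}

/-- The Zariski closure in `ℙ(V_x) × V_u`. -/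
def projZariskiClosure (A : Set (Projectivization ℂ (σ → ℂ) × (σ → ℂ))) :
    Set (Projectivization ℂ (σ → ℂ) × (σ → ℂ)) :=
  ⋂₀ {C | IsProjZariskiClosed C ∧ A ⊆ C}

variable [Fintype σ]

/-- The isotropic quadric `q x = 0`. -/
def isotropicQuadric : Set (σ → ℂ) := {x | ∑ i, x i ^ 2 = 0}

/-- The projective ED correspondence: the closure in `ℙ(V_x) × V_u` of the image of the pairs
`(x, u)` with `x ≠ 0` in the ED correspondence, under `(x, u) ↦ ([x], u)`. -/
def projEDCorrespondence (X : Set (σ → ℂ)) :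
    Set (Projectivization ℂ (σ → ℂ) × (σ → ℂ)) :=
  projZariskiClosure {p | ∃ (x : σ → ℂ) (hx : x ≠ 0),
    Sum.elim x p.2 ∈ edCorrespondence X ∧ p.1 = Projectivization.mk ℂ x hx}

/-- `X` is ED regular given `Z` (affine cones, seen as projective varieties): `Z` is not contained
in the union of the singular locus of `X` and the isotropic quadric, and the data locus is not
contained in the set of data points over which the fibre of the projective ED correspondence
(a closed subset of projective space) has positive dimension, i.e. is infinite. -/
def IsProjEDRegular (X Z : Set (σ → ℂ)) : Prop :=
  ¬ Z ⊆ singularLocus X ∪ isotropicQuadric ∧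
    ¬ dataLocus X Z ⊆ {u | {y : Projectivization ℂ (σ → ℂ) | (y, u) ∈ projEDCorrespondence X}.Infinite}

end Projective

end EDData

end

/-! Let `c` be the codimension of `X`. Near a smooth point, `c` polynomials `f j` of the ideal of
`X` have independent gradients, and these span the normal space. So over `Z` the correspondence is
parametrized by `(x, s) ↦ (x, x + ∑ j, s j • ∇ (f j) x)`. Evaluating at a generic point `(ξ, τ)` of
`Z × ℂ ^ c`, with function field `L`, gives a generic point `(ξ, u)` of the conditional ED
correspondence, where `u = genericData f ξ τ` (`mem_vanishingIdeal_condEDCorrespondence_iff`). The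
ideals of the correspondence and of the data locus are kernels of evaluations in a field, hence
prime. The bundle structure comes from Cramer's rule, which shows that the closure adds nothing to
the fibres over smooth points (`mem_condEDCorrespondence_iff`).

Since `L` has transcendence degree `dim Z + c`, the dimension formula holds once `L` is algebraic
over `ℂ(u)`, and for this it suffices that `ξ` is, because Cramer's rule recovers `τ` from `ξ` and
`u`.

Affine case: if some `ξ i` were transcendental over `ℂ(u)`, this coordinate would take infinitely
many values on the fibre over some point of the data locus in the good open set
(`exists_infinite_fiber`), against finiteness.

Projective case: a hyperplane `l = 0` avoids the finitely many critical points of one good data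
point. Every place of `L` centred at that data point keeps the ratios `ξ i / l ξ` finite, so they
are algebraic over `ℂ(u)` (`isAlgebraic_div_linearForm`). The scale `l ξ` is recovered from `⟨u, ξ⟩
= q ξ`, a consequence of Euler's relation, since `q ξ ≠ 0`. -/

noncomputable section

namespace EDData

open MvPolynomial

/-! ### Irreducible varieties and prime ideals. -/

section Irreducible

variable {σ : Type*}

theorem vanishingIdeal_zariskiClosure (S : Set (σ → ℂ)) :
    vanishingIdeal ℂ (zariskiClosure S) = vanishingIdeal ℂ S :=
  le_antisymm (vanishingIdeal_anti_mono (subset_zariskiClosure S))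
    (le_vanishingIdeal_zeroLocus _)

theorem IsZariskiClosed.zeroLocus_vanishingIdeal {S : Set (σ → ℂ)} (hS : IsZariskiClosed S) :
    zeroLocus ℂ (vanishingIdeal ℂ S) = S :=
  (zariskiClosure_subset hS subset_rfl).antisymm (subset_zariskiClosure S)

theorem IsIrreducibleVariety.isPrime_vanishingIdeal {S : Set (σ → ℂ)}
    (hS : IsIrreducibleVariety S) : (vanishingIdeal ℂ S).IsPrime := by
  obtain ⟨hc, ⟨p, hp⟩, hirr⟩ := hS
  refine ⟨fun h => ?_, fun {f g} hfg => ?_⟩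
  · have h1 : (1 : MvPolynomial σ ℂ) ∈ vanishingIdeal ℂ S := h ▸ Submodule.mem_top
    simpa using h1 p hp
  · have key := hirr (zeroLocus ℂ (vanishingIdeal ℂ S ⊔ Ideal.span {f}))
      (zeroLocus ℂ (vanishingIdeal ℂ S ⊔ Ideal.span {g})) ⟨_, rfl⟩ ⟨_, rfl⟩ ?_
    · refine key.imp (fun h => ?_) (fun h => ?_) <;> intro x hx <;> rw [h] at hx <;>
        exact hx _ (Ideal.mem_sup_right (Ideal.subset_span rfl))
    · have aux (q : MvPolynomial σ ℂ) (x : σ → ℂ) (hx : x ∈ S) (hq : aeval x q = 0) :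
          x ∈ zeroLocus ℂ (vanishingIdeal ℂ S ⊔ Ideal.span {q}) := by
        intro r hr
        obtain ⟨a, ha, b, hb, rfl⟩ := Submodule.mem_sup.1 hr
        obtain ⟨d, rfl⟩ := Ideal.mem_span_singleton.1 hb
        rw [map_add, map_mul, ha x hx, hq, zero_mul, add_zero]
      refine Set.Subset.antisymm (fun x hx => ?_) (Set.union_subset ?_ ?_)
      · have := hfg x hx
        rw [map_mul, mul_eq_zero] at this
        exact this.imp (aux f x hx) (aux g x hx)
      all_goals
        conv_rhs => rw [← hc.zeroLocus_vanishingIdeal]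
        exact zeroLocus_anti_mono le_sup_left

theorem isIrreducibleVariety_of_isPrime {S : Set (σ → ℂ)} (hc : IsZariskiClosed S)
    (hp : (vanishingIdeal ℂ S).IsPrime) : IsIrreducibleVariety S := by
  refine ⟨hc, ?_, fun A B hA hB hAB => ?_⟩
  · by_contra! h
    subst h
    exact hp.ne_top vanishingIdeal_empty
  · have key : vanishingIdeal ℂ A * vanishingIdeal ℂ B ≤ vanishingIdeal ℂ S := by
      refine Ideal.mul_le.2 fun f hf g hg x hx => ?_
      rw [hAB] at hx
      rcases hx with hx | hx
      · rw [map_mul, hf x hx, zero_mul]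
      · rw [map_mul, hg x hx, mul_zero]
    have aux {C : Set (σ → ℂ)} (hC : IsZariskiClosed C) (hCS : C ⊆ S)
        (h : vanishingIdeal ℂ C ≤ vanishingIdeal ℂ S) : S = C := by
      refine Set.Subset.antisymm ?_ hCS
      rw [← hc.zeroLocus_vanishingIdeal, ← hC.zeroLocus_vanishingIdeal]
      exact zeroLocus_anti_mono h
    exact (hp.mul_le.1 key).imp (aux hA (hAB ▸ Set.subset_union_left))
      (aux hB (hAB ▸ Set.subset_union_right))

end Irreducible

/-! ### Krull dimension as transcendence degree. -/

section Dimension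

/-- Lying over and going up lift chains of primes; incomparability makes contraction of primes
strictly monotone. -/
theorem ringKrullDim_eq_of_isIntegral {R S : Type*} [CommRing R] [CommRing S] [Algebra R S]
    [FaithfulSMul R S] [Algebra.IsIntegral R S] : ringKrullDim R = ringKrullDim S := by
  refine le_antisymm ?_ ?_
  · refine iSup_le fun l => ?_
    obtain ⟨P⟩ := (inferInstance : Nonempty (l.head.asIdeal.primesOver S))
    have := P.2.1
    have := P.2.2
    obtain ⟨L, hL, -⟩ := Ideal.exists_ltSeries_of_hasGoingUp (S := S) l P.1
    rw [← hL]
    exact Order.LTSeries.length_le_krullDim L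
  · refine Order.krullDim_le_of_strictMono (PrimeSpectrum.comap (algebraMap R S)) ?_
    intro I J h
    exact Ideal.IsIntegral.comap_lt_comap h

/-- By Noether normalization both sides equal the number of variables of a polynomial ring over
which `A` is integral. -/
theorem ringKrullDim_eq_trdeg (A : Type) [CommRing A] [IsDomain A] [Algebra ℂ A]
    [Algebra.FiniteType ℂ A] :
    ringKrullDim A = ((Cardinal.toNat (Algebra.trdeg ℂ A) : ℕ) : WithBot ℕ∞) := by
  obtain ⟨s, g, hg, hint⟩ := exists_integral_inj_algHom_of_fg ℂ A
  let := g.toRingHom.toAlgebra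
  have : IsScalarTower ℂ (MvPolynomial (Fin s) ℂ) A := .of_algHom g
  have : FaithfulSMul (MvPolynomial (Fin s) ℂ) A := (faithfulSMul_iff_algebraMap_injective _ _).2 hg
  have : Algebra.IsIntegral (MvPolynomial (Fin s) ℂ) A := ⟨hint⟩
  rw [← ringKrullDim_eq_of_isIntegral (R := MvPolynomial (Fin s) ℂ) (S := A),
    MvPolynomial.ringKrullDim_of_isNoetherianRing,
    ← trdeg_add_eq ℂ (MvPolynomial (Fin s) ℂ) (A := A), trdeg_eq_zero (R := MvPolynomial (Fin s) ℂ)]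
  simp

variable {σ : Type} [Finite σ]

theorem dim_eq_trdeg_adjoin {L : Type} [Field L] [Algebra ℂ L] {S : Set (σ → ℂ)} (y : σ → L)
    (h : vanishingIdeal ℂ S = RingHom.ker (aeval y : MvPolynomial σ ℂ →ₐ[ℂ] L)) :
    dim S = ((Cardinal.toNat (Algebra.trdeg ℂ (Algebra.adjoin ℂ (Set.range y))) : ℕ) :
      WithBot ℕ∞) := by
  have : Algebra.FiniteType ℂ (Algebra.adjoin ℂ (Set.range y)) :=
    (Subalgebra.fg_iff_finiteType _).1 ⟨(Set.finite_range y).toFinset, by simp⟩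
  let y' (i : σ) : Algebra.adjoin ℂ (Set.range y) := ⟨y i, Algebra.subset_adjoin ⟨i, rfl⟩⟩
  let f : MvPolynomial σ ℂ →+* Algebra.adjoin ℂ (Set.range y) :=
    (aeval y' : MvPolynomial σ ℂ →ₐ[ℂ] Algebra.adjoin ℂ (Set.range y)).toRingHom
  have hfy (p) : ((f p : Algebra.adjoin ℂ (Set.range y)) : L) = aeval y p :=
    (aeval_algebraMap_apply L y' p).symm
  have hf : Function.Surjective f := by
    rintro ⟨a, ha⟩
    rw [Algebra.adjoin_range_eq_range_aeval] at ha
    obtain ⟨p, rfl⟩ := ha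
    exact ⟨p, Subtype.ext (hfy p)⟩
  have hker : vanishingIdeal ℂ S = RingHom.ker f := by
    rw [h]
    ext p
    rw [RingHom.mem_ker, RingHom.mem_ker, ← hfy]
    exact ZeroMemClass.coe_eq_zero
  rw [dim, ringKrullDim_eq_of_ringEquiv ((Ideal.quotEquivOfEq hker).trans
    (RingHom.quotientKerEquivOfSurjective hf)), ringKrullDim_eq_trdeg]

theorem dim_le_card [Fintype σ] (S : Set (σ → ℂ)) :
    dim S ≤ ((Fintype.card σ : ℕ) : WithBot ℕ∞) := by
  refine (ringKrullDim_quotient_le _).trans ?_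
  rw [MvPolynomial.ringKrullDim_of_isNoetherianRing]
  simp

end Dimension

/-! ### Minors and linear independence. -/

section LinearAlgebra

variable {K σ : Type*} [Field K]

theorem exists_minor_ne_zero [Finite σ] {c : ℕ} {g : Fin c → σ → K} (hg : LinearIndependent K g) :
    ∃ e : Fin c → σ, (Matrix.of fun j k => g j (e k)).det ≠ 0 := by
  cases nonempty_fintype σ
  let M : Matrix (Fin c) σ K := Matrix.of g
  have hr : M.rank = c := by
    simpa using LinearIndependent.rank_matrix (M := M) hg
  have hspan : Submodule.span K (Set.range M.col) = ⊤ := by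
    apply Submodule.eq_top_of_finrank_eq
    rw [← Matrix.rank_eq_finrank_span_cols, hr]
    simp
  obtain ⟨b, hb, hbs, hbi⟩ := exists_linearIndependent K (Set.range M.col)
  rw [hspan] at hbs
  let B := Module.Basis.mk hbi (by simpa using hbs.ge)
  have hcard : Nat.card b = c := by
    rw [← Module.finrank_eq_nat_card_basis B]
    simp
  have : Finite b := (Set.finite_range M.col).subset hb
  let E : Fin c ≃ b := (finCongr hcard.symm).trans (Finite.equivFin b).symm
  choose e he using fun k => hb (E k).2
  refine ⟨e, ?_⟩
  have hli : LinearIndependent K (Matrix.of fun j k => g j (e k)).col := by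
    have : (Matrix.of fun j k => g j (e k)).col = Subtype.val ∘ E := by
      funext k
      rw [Function.comp_apply, ← he k]
      rfl
    rw [this]
    exact hbi.comp E E.injective
  exact ((Matrix.isUnit_iff_isUnit_det _).1 (Matrix.linearIndependent_cols_iff_isUnit.1 hli)).ne_zero

theorem linearIndependent_of_minor_ne_zero {c : ℕ} {g : Fin c → σ → K} {e : Fin c → σ}
    (h : (Matrix.of fun j k => g j (e k)).det ≠ 0) : LinearIndependent K g := by
  have := Matrix.linearIndependent_rows_iff_isUnit.2
    ((Matrix.isUnit_iff_isUnit_det _).2 (isUnit_iff_ne_zero.2 h))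
  exact LinearIndependent.of_comp (LinearMap.funLeft K K e) this

end LinearAlgebra

/-! ### The Jacobian criterion, normal spaces and smooth points. -/

section Jacobian

variable {σ : Type} [Fintype σ]

theorem derivation_aeval {L M : Type*} [CommRing L] [Algebra ℂ L] [AddCommGroup M] [Module L M]
    [Module ℂ M] [IsScalarTower ℂ L M] (D : Derivation ℂ L M) (y : σ → L) (f : MvPolynomial σ ℂ) :
    D (aeval y f) = ∑ i, aeval y (pderiv i f) • D (y i) := by
  classical
  induction f using MvPolynomial.induction_on with
  | C a => simp
  | add p q hp hq => simp [hp, hq, add_smul, Finset.sum_add_distrib]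
  | mul_X p i hp =>
    simp [hp, Derivation.leibniz, add_smul, Finset.sum_add_distrib, Finset.smul_sum, smul_smul,
      pderiv_X, Pi.single_apply, apply_ite]

open IntermediateField.algebraAdjoinAdjoin in
theorem isAlgebraic_algebraAdjoin {L : Type*} [Field L] [Algebra ℂ L] {s : Set L}
    (_ : Algebra.IsAlgebraic (IntermediateField.adjoin ℂ s) L) :
    Algebra.IsAlgebraic (Algebra.adjoin ℂ s) L :=
  (IsFractionRing.comap_isAlgebraic_iff (K := IntermediateField.adjoin ℂ s)).2 inferInstance

/-- If the columns `e` of the Jacobian matrix of relations `f` between generators `y` of a field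
are independent, then the other generators contain a transcendence basis. -/
theorem trdeg_add_le_card_of_jacobian {L : Type} [Field L] [Algebra ℂ L]
    [Algebra.EssFiniteType ℂ L] (y : σ → L) (hy : IntermediateField.adjoin ℂ (Set.range y) = ⊤)
    {c : ℕ} (f : Fin c → MvPolynomial σ ℂ) (hf : ∀ j, aeval y (f j) = 0) (e : Fin c → σ)
    (he : (Matrix.of fun j k => aeval y (pderiv (e k) (f j))).det ≠ 0) :
    Cardinal.toNat (Algebra.trdeg ℂ L) + c ≤ Fintype.card σ := by
  classical
  have he_inj : Function.Injective e := by
    intro k l hkl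
    by_contra hne
    exact he (Matrix.det_zero_of_column_eq hne fun j => by simp [hkl])
  let s : Set L := y '' (Set.range e)ᶜ
  let F := IntermediateField.adjoin ℂ s
  have hD0 (i : σ) (hi : i ∉ Set.range e) : KaehlerDifferential.D F L (y i) = 0 := by
    have : y i ∈ F := IntermediateField.subset_adjoin ℂ s ⟨i, hi, rfl⟩
    exact (KaehlerDifferential.D F L).map_algebraMap ⟨y i, this⟩
  -- Differentiating `f j (y) = 0` leaves only the differentials of the `y (e k)`, as the other
  -- generators lie in `F`; the invertible minor then kills these too.
  have hDe : ∀ k, KaehlerDifferential.D F L (y (e k)) = 0 := by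
    have hrel (j : Fin c) :
        ∑ k, aeval y (pderiv (e k) (f j)) • KaehlerDifferential.D F L (y (e k)) = 0 := by
      have h1 := derivation_aeval ((KaehlerDifferential.D F L).restrictScalars ℂ) y (f j)
      rw [hf j, map_zero] at h1
      rw [h1, ← Finset.sum_subset (Finset.subset_univ (Finset.univ.image e)),
        Finset.sum_image (fun _ _ _ _ h => he_inj h)]
      · rfl
      · intro i _ hi
        have : i ∉ Set.range e := by simpa using hi
        rw [Derivation.coe_restrictScalars, hD0 i this, smul_zero]
    let G : Matrix (Fin c) (Fin c) L := Matrix.of fun j k => aeval y (pderiv (e k) (f j))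
    intro l
    have : G⁻¹ * G = 1 := Matrix.nonsing_inv_mul _ (isUnit_iff_ne_zero.2 he)
    have h2 : ∑ j, G⁻¹ l j • ∑ k, G j k • KaehlerDifferential.D F L (y (e k)) = 0 :=
      Finset.sum_eq_zero fun j _ => (congrArg (G⁻¹ l j • ·) (hrel j)).trans (smul_zero _)
    simp_rw [Finset.smul_sum, smul_smul] at h2
    rw [Finset.sum_comm] at h2
    simp_rw [← Finset.sum_smul, ← Matrix.mul_apply, this] at h2
    simpa [Matrix.one_apply] using h2
  have hD (a : L) : KaehlerDifferential.D F L a = 0 := by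
    have ha : a ∈ IntermediateField.adjoin ℂ (Set.range y) := hy ▸ IntermediateField.mem_top
    induction ha using IntermediateField.adjoin_induction with
    | mem x hx =>
      obtain ⟨i, rfl⟩ := hx
      by_cases hi : i ∈ Set.range e
      · obtain ⟨k, rfl⟩ := hi
        exact hDe k
      · exact hD0 i hi
    | algebraMap x => exact ((KaehlerDifferential.D F L).restrictScalars ℂ).map_algebraMap x
    | add x y _ _ hx hy => rw [map_add, hx, hy, add_zero]
    | inv x _ hx => rw [Derivation.leibniz_inv, hx, smul_zero]
    | mul x y _ _ hx hy => rw [Derivation.leibniz, hx, hy, smul_zero, smul_zero, add_zero]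
  -- With all differentials zero, `L` is unramified, hence separable algebraic, over `F`, so the
  -- generators outside `e` bound the transcendence degree.
  have : Algebra.FormallyUnramified F L := by
    refine ⟨⟨?_⟩⟩
    have h0 (w : Ω[L⁄F]) : w = 0 := by
      have hw : w ∈ Submodule.span L (Set.range (KaehlerDifferential.D F L)) :=
        KaehlerDifferential.span_range_derivation F L ▸ Submodule.mem_top
      rw [show Set.range (KaehlerDifferential.D F L) = {0} from ?_] at hw
      · simpa using hw
      · refine Set.eq_singleton_iff_unique_mem.2 ⟨⟨0, map_zero _⟩, ?_⟩
        rintro _ ⟨a, rfl⟩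
        exact hD a
    intro a b
    rw [h0 a, h0 b]
  have : Algebra.EssFiniteType F L := Algebra.EssFiniteType.of_comp ℂ F L
  have : Algebra.IsSeparable F L := Algebra.FormallyUnramified.isSeparable F L
  have hF : Algebra.trdeg ℂ L ≤ Cardinal.mk s := by
    have := isAlgebraic_algebraAdjoin (s := s) (L := L) inferInstance
    exact Algebra.IsAlgebraic.trdeg_le_cardinalMk ℂ s
  have hs : Cardinal.mk s ≤ ((Fintype.card σ - c : ℕ) : Cardinal) := by
    refine Cardinal.mk_image_le.trans ?_
    rw [Cardinal.mk_fintype, Fintype.card_compl_set, Set.card_range_of_injective he_inj,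
      Fintype.card_fin]
  have h3 := Cardinal.toNat_le_toNat (hF.trans hs) (Cardinal.natCast_lt_aleph0)
  rw [Cardinal.toNat_natCast] at h3
  have h4 : c ≤ Fintype.card σ := by simpa using Fintype.card_le_of_injective e he_inj
  omega

/-- The gradient of `f` at `x`. -/
def gradient (f : MvPolynomial σ ℂ) (x : σ → ℂ) : σ → ℂ := fun i => eval x (pderiv i f)

/-- The span of the gradients at `x` of the polynomials vanishing on `X`. -/
def gradientSpace (X : Set (σ → ℂ)) (x : σ → ℂ) : Submodule ℂ (σ → ℂ) where
  carrier := {w | ∃ f ∈ vanishingIdeal ℂ X, gradient f x = w}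
  add_mem' := by
    rintro _ _ ⟨f, hf, rfl⟩ ⟨g, hg, rfl⟩
    exact ⟨f + g, add_mem hf hg, by ext; simp [gradient]⟩
  zero_mem' := ⟨0, zero_mem _, by ext; simp [gradient]⟩
  smul_mem' := by
    rintro a _ ⟨f, hf, rfl⟩
    exact ⟨C a * f, Ideal.mul_mem_left _ _ hf, by ext; simp [gradient]⟩

/-- The standard bilinear form `∑ i, y i * v i`. -/
abbrev dotForm (σ : Type) [Fintype σ] : LinearMap.BilinForm ℂ (σ → ℂ) := dotProductBilin ℂ ℂ

theorem dotForm_nondegenerate : (dotForm σ).Nondegenerate := by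
  refine ⟨fun v hv => ?_, fun v hv => ?_⟩
  · exact dotProduct_eq_zero v hv
  · exact dotProduct_eq_zero v fun w => (dotProduct_comm v w).trans (hv w)

theorem dotForm_isRefl : (dotForm σ).IsRefl := fun v w h => (dotProduct_comm w v).trans h

theorem tangentSpace_eq_orthogonal (X : Set (σ → ℂ)) (x : σ → ℂ) :
    tangentSpace X x = (dotForm σ).orthogonal (gradientSpace X x) := by
  ext v
  refine ⟨?_, fun h f hf => h _ ⟨f, hf, rfl⟩⟩
  rintro h _ ⟨f, hf, rfl⟩
  exact h f hf

/-- The double orthogonal needs only nondegeneracy of the form, so isotropic vectors do no harm.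
This turns the normal condition into a parametrization by gradients. -/
theorem normalSpace_eq_gradientSpace (X : Set (σ → ℂ)) (x : σ → ℂ) :
    normalSpace X x = gradientSpace X x := by
  rw [← LinearMap.BilinForm.orthogonal_orthogonal dotForm_nondegenerate dotForm_isRefl
    (gradientSpace X x), ← tangentSpace_eq_orthogonal]
  ext y
  exact forall₂_congr fun v _ => Eq.congr_left (dotProduct_comm y v)

theorem finrank_gradientSpace_add (X : Set (σ → ℂ)) (x : σ → ℂ) :
    Module.finrank ℂ (gradientSpace X x) + Module.finrank ℂ (tangentSpace X x) =
      Fintype.card σ := by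
  have h := LinearMap.BilinForm.finrank_orthogonal (dotForm_nondegenerate (σ := σ))
    (gradientSpace X x)
  have h2 := Submodule.finrank_le (gradientSpace X x)
  rw [← tangentSpace_eq_orthogonal] at h
  rw [Module.finrank_fintype_fun_eq_card] at h h2
  omega

/-- The minor with columns `e` of the Jacobian matrix of `f`. -/
def jacobianMinor {c : ℕ} (f : Fin c → MvPolynomial σ ℂ) (e : Fin c → σ) : MvPolynomial σ ℂ :=
  (Matrix.of fun j k => pderiv (e k) (f j)).det

omit [Fintype σ] in
theorem map_jacobianMinor {c : ℕ} {L : Type*} [CommRing L] (φ : MvPolynomial σ ℂ →+* L)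
    (f : Fin c → MvPolynomial σ ℂ) (e : Fin c → σ) :
    φ (jacobianMinor f e) = (Matrix.of fun j k => φ (pderiv (e k) (f j))).det := by
  rw [jacobianMinor, RingHom.map_det]
  rfl

theorem exists_jacobianMinor_ne_zero {X : Set (σ → ℂ)} {x : σ → ℂ} {c : ℕ}
    (hc : Module.finrank ℂ (gradientSpace X x) = c) :
    ∃ (f : Fin c → MvPolynomial σ ℂ) (e : Fin c → σ),
      (∀ j, f j ∈ vanishingIdeal ℂ X) ∧ eval x (jacobianMinor f e) ≠ 0 := by
  let b := Module.finBasisOfFinrankEq ℂ (gradientSpace X x) hc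
  choose f hf hfb using fun j => (b j).2
  have hli : LinearIndependent ℂ fun j => gradient (f j) x := by
    simp_rw [hfb]
    exact b.linearIndependent.map' (Submodule.subtype _) (Submodule.ker_subtype _)
  obtain ⟨e, he⟩ := exists_minor_ne_zero hli
  exact ⟨f, e, hf, by rwa [map_jacobianMinor]⟩

omit [Fintype σ] in
theorem linearIndependent_gradient {x : σ → ℂ} {c : ℕ} {f : Fin c → MvPolynomial σ ℂ}
    {e : Fin c → σ} (h : eval x (jacobianMinor f e) ≠ 0) :
    LinearIndependent ℂ fun j => gradient (f j) x := by
  rw [map_jacobianMinor] at h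
  exact linearIndependent_of_minor_ne_zero (e := e) h

omit [Fintype σ] in
theorem span_gradient_le {X : Set (σ → ℂ)} (x : σ → ℂ) {c : ℕ} {f : Fin c → MvPolynomial σ ℂ}
    (hf : ∀ j, f j ∈ vanishingIdeal ℂ X) :
    Submodule.span ℂ (Set.range fun j => gradient (f j) x) ≤ gradientSpace X x := by
  rw [Submodule.span_le]
  rintro _ ⟨j, rfl⟩
  exact ⟨f j, hf j, rfl⟩

/-- The coordinate ring of an affine variety. -/
abbrev CoordRing (X : Set (σ → ℂ)) : Type := MvPolynomial σ ℂ ⧸ vanishingIdeal ℂ X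

/-- A minor that is nonzero at one point of `X` is nonzero in the function field, where
`trdeg_add_le_card_of_jacobian` applies. Being valid at singular points too, the bound makes a
single nonzero minor of size `codim X` a proof of smoothness. -/
theorem dim_add_finrank_gradientSpace_le {X : Set (σ → ℂ)} (hX : IsIrreducibleVariety X)
    {x : σ → ℂ} (hx : x ∈ X) :
    dim X + ((Module.finrank ℂ (gradientSpace X x) : ℕ) : WithBot ℕ∞) ≤
      ((Fintype.card σ : ℕ) : WithBot ℕ∞) := by
  have := hX.isPrime_vanishingIdeal
  obtain ⟨f, e, hf, hfe⟩ := exists_jacobianMinor_ne_zero (X := X) (x := x) rfl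
  let L := FractionRing (CoordRing X)
  let π : MvPolynomial σ ℂ →ₐ[ℂ] L :=
    (IsScalarTower.toAlgHom ℂ (CoordRing X) L).comp (Ideal.Quotient.mkₐ ℂ _)
  have hπ0 (p : MvPolynomial σ ℂ) : π p = 0 ↔ p ∈ vanishingIdeal ℂ X := by
    change algebraMap (CoordRing X) L (Ideal.Quotient.mk _ p) = 0 ↔ _
    rw [FaithfulSMul.algebraMap_eq_zero_iff, Ideal.Quotient.eq_zero_iff_mem]
  let y (i : σ) : L := π (MvPolynomial.X i)
  have hy (p : MvPolynomial σ ℂ) : aeval y p = π p := by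
    rw [show aeval y = π from (aeval_unique π).symm]
  have hgen : IntermediateField.adjoin ℂ (Set.range y) = ⊤ := by
    refine eq_top_iff.2 fun a _ => ?_
    have hmem (q : CoordRing X) : algebraMap (CoordRing X) L q ∈
        IntermediateField.adjoin ℂ (Set.range y) := by
      obtain ⟨p, rfl⟩ := Ideal.Quotient.mk_surjective q
      change π p ∈ _
      rw [← hy]
      apply IntermediateField.algebra_adjoin_le_adjoin
      rw [Algebra.adjoin_range_eq_range_aeval]
      exact ⟨p, rfl⟩
    obtain ⟨p, q, _, rfl⟩ := IsFractionRing.div_surjective (A := CoordRing X) a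
    exact div_mem (hmem p) (hmem q)
  have : Algebra.EssFiniteType ℂ L := Algebra.EssFiniteType.comp ℂ (CoordRing X) L
  have key := trdeg_add_le_card_of_jacobian y hgen f
    (fun j => by rw [hy, hπ0]; exact hf j) e ?_
  · have : Algebra.IsAlgebraic (CoordRing X) L :=
      IsLocalization.isAlgebraic _ (nonZeroDivisors (CoordRing X))
    rw [dim, ringKrullDim_eq_trdeg, ← trdeg_add_eq ℂ (CoordRing X) (A := L),
      trdeg_eq_zero (R := CoordRing X), add_zero] at *
    exact_mod_cast key
  · have h1 := map_jacobianMinor (aeval y : MvPolynomial σ ℂ →ₐ[ℂ] L).toRingHom f e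
    intro h0
    refine hfe (((hπ0 _).1 ?_) x hx)
    rw [← hy]
    exact h1.trans h0

theorem exists_nat_eq_of_add_eq {a : WithBot ℕ∞} {c n : ℕ}
    (h : a + (c : WithBot ℕ∞) = (n : WithBot ℕ∞)) : ∃ d : ℕ, a = d ∧ d + c = n := by
  induction a with
  | bot => simp at h
  | coe a =>
    induction a with
    | top => exact absurd h (by exact_mod_cast WithBot.coe_inj.not.2 (by simp))
    | coe a => exact ⟨a, rfl, by exact_mod_cast h⟩

theorem mem_smoothLocus_iff {X : Set (σ → ℂ)} {c : ℕ}
    (hc : dim X + (c : WithBot ℕ∞) = ((Fintype.card σ : ℕ) : WithBot ℕ∞)) {x : σ → ℂ} :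
    x ∈ smoothLocus X ↔ x ∈ X ∧ Module.finrank ℂ (gradientSpace X x) = c := by
  obtain ⟨d, hd, hdc⟩ := exists_nat_eq_of_add_eq hc
  have := finrank_gradientSpace_add X x
  refine and_congr_right fun _ => ?_
  rw [hd]
  norm_cast
  omega

/-- The `c` independent gradients bound the rank below, and the dimension inequality bounds it
above. Hence one family `f` serves as a frame of normal vectors wherever its minor is nonzero. -/
theorem finrank_gradientSpace_of_jacobianMinor {X : Set (σ → ℂ)} (hX : IsIrreducibleVariety X)
    {c : ℕ} (hc : dim X + (c : WithBot ℕ∞) = ((Fintype.card σ : ℕ) : WithBot ℕ∞)) {x : σ → ℂ}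
    (hx : x ∈ X) {f : Fin c → MvPolynomial σ ℂ} (hf : ∀ j, f j ∈ vanishingIdeal ℂ X)
    {e : Fin c → σ} (h : eval x (jacobianMinor f e) ≠ 0) :
    Module.finrank ℂ (gradientSpace X x) = c := by
  have h1 := dim_add_finrank_gradientSpace_le hX hx
  have h2 := Submodule.finrank_mono (span_gradient_le x hf)
  rw [finrank_span_eq_card (linearIndependent_gradient h), Fintype.card_fin] at h2
  obtain ⟨d, hd, hdc⟩ := exists_nat_eq_of_add_eq hc
  rw [hd] at h1
  norm_cast at h1
  omega

theorem mem_smoothLocus_of_jacobianMinor {X : Set (σ → ℂ)} (hX : IsIrreducibleVariety X)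
    {c : ℕ} (hc : dim X + (c : WithBot ℕ∞) = ((Fintype.card σ : ℕ) : WithBot ℕ∞)) {x : σ → ℂ}
    (hx : x ∈ X) {f : Fin c → MvPolynomial σ ℂ} (hf : ∀ j, f j ∈ vanishingIdeal ℂ X)
    {e : Fin c → σ} (h : eval x (jacobianMinor f e) ≠ 0) : x ∈ smoothLocus X :=
  (mem_smoothLocus_iff hc).2 ⟨hx, finrank_gradientSpace_of_jacobianMinor hX hc hx hf h⟩

theorem mem_normalSpace_iff_of_jacobianMinor {X : Set (σ → ℂ)} (hX : IsIrreducibleVariety X)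
    {c : ℕ} (hc : dim X + (c : WithBot ℕ∞) = ((Fintype.card σ : ℕ) : WithBot ℕ∞)) {x : σ → ℂ}
    (hx : x ∈ X) {f : Fin c → MvPolynomial σ ℂ} (hf : ∀ j, f j ∈ vanishingIdeal ℂ X)
    {e : Fin c → σ} (h : eval x (jacobianMinor f e) ≠ 0) (w : σ → ℂ) :
    w ∈ normalSpace X x ↔ w ∈ Submodule.span ℂ (Set.range fun j => gradient (f j) x) := by
  rw [normalSpace_eq_gradientSpace, SetLike.mem_coe,
    Submodule.eq_of_le_of_finrank_eq (span_gradient_le x hf)]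
  rw [finrank_span_eq_card (linearIndependent_gradient h), Fintype.card_fin,
    finrank_gradientSpace_of_jacobianMinor hX hc hx hf h]

theorem exists_chart {X : Set (σ → ℂ)} {c : ℕ}
    (hc : dim X + (c : WithBot ℕ∞) = ((Fintype.card σ : ℕ) : WithBot ℕ∞)) {x : σ → ℂ}
    (hx : x ∈ smoothLocus X) :
    ∃ (f : Fin c → MvPolynomial σ ℂ) (e : Fin c → σ),
      (∀ j, f j ∈ vanishingIdeal ℂ X) ∧ eval x (jacobianMinor f e) ≠ 0 :=
  exists_jacobianMinor_ne_zero ((mem_smoothLocus_iff hc).1 hx).2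

end Jacobian

/-! ### The generic point of `Z × ℂ ^ c`. -/

section GenericPoint

variable {σ : Type} {c : ℕ}

/-- `(ξ, τ)` is a generic point of `Z × ℂ ^ c`, with function field `L`. -/
structure IsGenericPoint {L : Type} [Field L] [Algebra ℂ L] (Z : Set (σ → ℂ)) (ξ : σ → L)
    (τ : Fin c → L) : Prop where
  aeval_eq_zero_iff : ∀ P : MvPolynomial (σ ⊕ Fin c) ℂ, aeval (Sum.elim ξ τ) P = 0 ↔
    ∀ x ∈ Z, ∀ s : Fin c → ℂ, eval (Sum.elim x s) P = 0
  adjoin_eq_top : IntermediateField.adjoin ℂ (Set.range ξ ∪ Set.range τ) = ⊤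
  dim_add : dim Z + (c : WithBot ℕ∞) = ((Cardinal.toNat (Algebra.trdeg ℂ L) : ℕ) : WithBot ℕ∞)

theorem exists_isGenericPoint [Fintype σ] {Z : Set (σ → ℂ)} (hZ : IsIrreducibleVariety Z) (c : ℕ) :
    ∃ (L : Type) (_ : Field L) (_ : Algebra ℂ L) (ξ : σ → L) (τ : Fin c → L),
      IsGenericPoint Z ξ τ := by
  have := hZ.isPrime_vanishingIdeal
  let A := CoordRing Z
  let M := MvPolynomial (Fin c) A
  let L := FractionRing M
  let v : σ ⊕ Fin c → M := Sum.elim (fun i => C (Ideal.Quotient.mk _ (X i))) X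
  let ξ (i : σ) : L := algebraMap M L (v (Sum.inl i))
  let τ (j : Fin c) : L := algebraMap M L (v (Sum.inr j))
  have hv : Sum.elim ξ τ = fun k => algebraMap M L (v k) := by
    ext (i | j) <;> rfl
  have haeval (P : MvPolynomial (σ ⊕ Fin c) ℂ) :
      aeval (Sum.elim ξ τ) P = algebraMap M L (aeval v P) := by
    rw [hv]
    exact aeval_algebraMap_apply L v P
  let ev (x : σ → ℂ) (hx : x ∈ Z) : A →ₐ[ℂ] ℂ :=
    Ideal.Quotient.liftₐ _ (aeval x) fun p hp => hp x hx
  have hev (x : σ → ℂ) (hx : x ∈ Z) (s : Fin c → ℂ) (P : MvPolynomial (σ ⊕ Fin c) ℂ) :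
      eval s (map (ev x hx).toRingHom (aeval v P)) = eval (Sum.elim x s) P := by
    induction P using MvPolynomial.induction_on with
    | C a =>
      rw [aeval_C, eval_C, MvPolynomial.algebraMap_apply, map_C, eval_C]
      exact (ev x hx).commutes a
    | add p q hp hq => simp only [map_add, hp, hq]
    | mul_X p k hp =>
      rw [map_mul, map_mul, map_mul, map_mul, hp, aeval_X, eval_X]
      congr 1
      rcases k with i | j
      · simp only [v, Sum.elim_inl, map_C, eval_C]
        exact aeval_X x i
      · simp [v]
  refine ⟨L, inferInstance, inferInstance, ξ, τ, ?_, ?_, ?_⟩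
  · intro P
    rw [haeval]
    refine (map_eq_zero_iff (algebraMap M L) (IsFractionRing.injective M L)).trans ?_
    refine ⟨fun h x hx s => by rw [← hev x hx, h, map_zero, map_zero], fun h => ?_⟩
    -- For each fixed `x` the specialized polynomial vanishes on all of `ℂ ^ c`, so it is zero; each
    -- coefficient thus vanishes at every point of `Z`.
    ext m
    rw [coeff_zero]
    obtain ⟨p, hp⟩ := Ideal.Quotient.mk_surjective (coeff m (aeval v P))
    rw [← hp, Ideal.Quotient.eq_zero_iff_mem]
    intro x hx
    have h0 : map (ev x hx).toRingHom (aeval v P) = 0 :=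
      MvPolynomial.funext fun s => by rw [hev x hx, h x hx, map_zero]
    have h1 := congrArg (coeff m) h0
    rw [coeff_map, ← hp, coeff_zero] at h1
    exact h1
  · refine eq_top_iff.2 fun a _ => ?_
    have hmem (q : M) : algebraMap M L q ∈
        IntermediateField.adjoin ℂ (Set.range ξ ∪ Set.range τ) := by
      induction q using MvPolynomial.induction_on with
      | C a =>
        obtain ⟨p, rfl⟩ := Ideal.Quotient.mk_surjective a
        have : algebraMap M L (C (Ideal.Quotient.mk _ p)) = aeval ξ p := by
          refine DFunLike.congr_fun (f := ((IsScalarTower.toAlgHom ℂ M L).comp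
            ((IsScalarTower.toAlgHom ℂ A M).comp (Ideal.Quotient.mkₐ ℂ _)))) ?_ p
          ext i
          rw [aeval_X]
          rfl
        rw [this]
        apply IntermediateField.algebra_adjoin_le_adjoin
        apply Algebra.adjoin_mono Set.subset_union_left
        rw [Algebra.adjoin_range_eq_range_aeval]
        exact ⟨p, rfl⟩
      | add p q hp hq =>
        rw [map_add]
        exact add_mem hp hq
      | mul_X p j hp =>
        rw [map_mul]
        exact mul_mem hp (IntermediateField.subset_adjoin _ _ (Or.inr ⟨j, rfl⟩))
    obtain ⟨p, q, _, rfl⟩ := IsFractionRing.div_surjective (A := M) a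
    exact div_mem (hmem p) (hmem q)
  · have : Algebra.IsAlgebraic M L := IsLocalization.isAlgebraic _ (nonZeroDivisors M)
    rw [dim, ringKrullDim_eq_trdeg, ← trdeg_add_eq ℂ M (A := L),
      trdeg_eq_zero (R := M), add_zero, ← trdeg_add_eq ℂ A (A := M),
      MvPolynomial.trdeg_of_isDomain, Cardinal.toNat_add
        (trdeg_lt_aleph0_of_finiteType) (by simp)]
    simp
    rfl

namespace IsGenericPoint

variable {L : Type} [Field L] [Algebra ℂ L] {Z : Set (σ → ℂ)} {ξ : σ → L} {τ : Fin c → L}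

theorem aeval_left_eq_zero_iff (hg : IsGenericPoint Z ξ τ) (p : MvPolynomial σ ℂ) :
    aeval ξ p = 0 ↔ p ∈ vanishingIdeal ℂ Z := by
  have h := hg.aeval_eq_zero_iff (rename Sum.inl p)
  simp only [aeval_rename, eval_rename, Sum.elim_comp_inl] at h
  rw [h]
  exact forall₂_congr fun x _ => forall_const _

/-- Multiplying by `w` gives vanishing everywhere, and `w` cancels in the field `L`. Identities thus
need checking only on a nonempty open part of `Z`. -/
theorem aeval_eq_zero_of_forall (hg : IsGenericPoint Z ξ τ) {w : MvPolynomial σ ℂ}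
    {z : σ → ℂ} (hz : z ∈ Z) (hw : eval z w ≠ 0) (P : MvPolynomial (σ ⊕ Fin c) ℂ)
    (h : ∀ x ∈ Z, eval x w ≠ 0 → ∀ s : Fin c → ℂ, eval (Sum.elim x s) P = 0) :
    aeval (Sum.elim ξ τ) P = 0 := by
  have h1 : aeval (Sum.elim ξ τ) (rename Sum.inl w * P) = 0 := by
    rw [hg.aeval_eq_zero_iff]
    intro x hx s
    rw [map_mul, eval_rename, Sum.elim_comp_inl, mul_eq_zero, or_iff_not_imp_left]
    exact fun hne => h x hx hne s
  rw [map_mul, aeval_rename, Sum.elim_comp_inl, mul_eq_zero] at h1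
  exact h1.resolve_left fun h0 => hw ((hg.aeval_left_eq_zero_iff w).1 h0 z hz)

end IsGenericPoint

end GenericPoint

/-! ### The generic point and the fibres of the conditional ED correspondence. -/

section Correspondence

variable {σ : Type} [Fintype σ] {c : ℕ} {L : Type} [Field L] [Algebra ℂ L]

/-- The data point `ξ + ∑ j, τ j • ∇ (f j) ξ`. -/
def genericData (f : Fin c → MvPolynomial σ ℂ) (ξ : σ → L) (τ : Fin c → L) : σ → L :=
  fun i => ξ i + ∑ j, τ j * aeval ξ (pderiv i (f j))

/-- The pullback of a polynomial under `(x, s) ↦ (x, x + ∑ j, s j • ∇ (f j) x)`. -/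
def pullback (f : Fin c → MvPolynomial σ ℂ) (F : MvPolynomial (σ ⊕ σ) ℂ) :
    MvPolynomial (σ ⊕ Fin c) ℂ :=
  aeval (Sum.elim (fun i => X (Sum.inl i)) fun i =>
    X (Sum.inl i) + ∑ j, X (Sum.inr j) * rename Sum.inl (pderiv i (f j))) F

omit [Fintype σ] in
theorem aeval_pullback (f : Fin c → MvPolynomial σ ℂ) (F : MvPolynomial (σ ⊕ σ) ℂ) (ξ : σ → L)
    (τ : Fin c → L) :
    aeval (Sum.elim ξ τ) (pullback f F) = aeval (Sum.elim ξ (genericData f ξ τ)) F := by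
  rw [pullback, ← AlgHom.comp_apply, comp_aeval]
  congr 2
  ext (i | i) <;> simp [genericData, aeval_rename]

omit [Fintype σ] in
theorem eval_pullback (f : Fin c → MvPolynomial σ ℂ) (F : MvPolynomial (σ ⊕ σ) ℂ) (x : σ → ℂ)
    (s : Fin c → ℂ) :
    eval (Sum.elim x s) (pullback f F) =
      eval (Sum.elim x (x + ∑ j, s j • gradient (f j) x)) F := by
  have h : eval _ (pullback f F) = eval _ F := aeval_pullback f F x s
  rw [show (x + ∑ j, s j • gradient (f j) x) = genericData f x s from ?_]
  · exact h
  · ext i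
    simp [genericData, gradient]

variable {X Z : Set (σ → ℂ)} {ξ : σ → L} {τ : Fin c → L}

/-- A single chart meeting `Z` determines the whole closure, because `Z` is irreducible: any other
chart of `X` meeting `Z` overlaps it on `Z`. -/
theorem mem_vanishingIdeal_condEDCorrespondence_iff (hX : IsIrreducibleVariety X) (hZX : Z ⊆ X)
    (hc : dim X + (c : WithBot ℕ∞) = ((Fintype.card σ : ℕ) : WithBot ℕ∞))
    (hg : IsGenericPoint Z ξ τ) {f : Fin c → MvPolynomial σ ℂ}
    (hf : ∀ j, f j ∈ vanishingIdeal ℂ X) {e : Fin c → σ} {z : σ → ℂ} (hz : z ∈ Z)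
    (hze : eval z (jacobianMinor f e) ≠ 0) (F : MvPolynomial (σ ⊕ σ) ℂ) :
    F ∈ vanishingIdeal ℂ (condEDCorrespondence X Z) ↔
      aeval (Sum.elim ξ (genericData f ξ τ)) F = 0 := by
  have hmem (x : σ → ℂ) (hx : x ∈ Z) {g : Fin c → MvPolynomial σ ℂ}
      (hg : ∀ j, g j ∈ vanishingIdeal ℂ X) {e' : Fin c → σ}
      (h : eval x (jacobianMinor g e') ≠ 0) (u : σ → ℂ) :
      IsCritical X u x ↔ ∃ s : Fin c → ℂ, u = x + ∑ j, s j • gradient (g j) x := by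
    rw [IsCritical, mem_normalSpace_iff_of_jacobianMinor hX hc (hZX hx) hg h,
      Submodule.mem_span_range_iff_exists_fun]
    refine exists_congr fun s => ?_
    rw [eq_comm, sub_eq_iff_eq_add']
  rw [condEDCorrespondence, vanishingIdeal_zariskiClosure]
  constructor
  · intro hF
    rw [← aeval_pullback]
    refine hg.aeval_eq_zero_of_forall hz hze _ fun x hx hxe s => ?_
    rw [eval_pullback]
    exact hF _ ⟨x, _, rfl, ⟨mem_smoothLocus_of_jacobianMinor hX hc (hZX hx) hf hxe, hx⟩,
      (hmem x hx hf hxe _).2 ⟨s, rfl⟩⟩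
  · rintro hF _ ⟨x, u, rfl, ⟨hxs, hxZ⟩, hu⟩
    obtain ⟨g, e', hg', hxe'⟩ := exists_chart hc hxs
    obtain ⟨s, rfl⟩ := (hmem x hxZ hg' hxe' u).1 hu
    rw [← aeval_pullback] at hF
    -- Where both minors are nonzero, the frames `f` and `g` span the same normal space, so
    -- vanishing of `F` passes from one parametrization to the other. The minor of `f` discards the
    -- points outside the overlap.
    have h0 : aeval (Sum.elim ξ τ) (rename Sum.inl (jacobianMinor f e) * pullback g F) = 0 := by
      refine hg.aeval_eq_zero_of_forall hxZ hxe' _ fun y hy hye' t => ?_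
      rw [map_mul, eval_rename, Sum.elim_comp_inl, mul_eq_zero, or_iff_not_imp_left]
      intro hye
      obtain ⟨t', ht'⟩ := (hmem y hy hf hye _).1 ((hmem y hy hg' hye' _).2 ⟨t, rfl⟩)
      rw [eval_pullback, ht', ← eval_pullback]
      exact (hg.aeval_eq_zero_iff _).1 hF y hy t'
    rw [map_mul, aeval_rename, Sum.elim_comp_inl, mul_eq_zero] at h0
    have h1 := h0.resolve_left fun h0 => hze ((hg.aeval_left_eq_zero_iff _).1 h0 z hz)
    change eval _ F = 0
    rw [← eval_pullback]
    exact (hg.aeval_eq_zero_iff _).1 h1 x hxZ s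

theorem mem_vanishingIdeal_dataLocus_iff (hX : IsIrreducibleVariety X) (hZX : Z ⊆ X)
    (hc : dim X + (c : WithBot ℕ∞) = ((Fintype.card σ : ℕ) : WithBot ℕ∞))
    (hg : IsGenericPoint Z ξ τ) {f : Fin c → MvPolynomial σ ℂ}
    (hf : ∀ j, f j ∈ vanishingIdeal ℂ X) {e : Fin c → σ} {z : σ → ℂ} (hz : z ∈ Z)
    (hze : eval z (jacobianMinor f e) ≠ 0) (F : MvPolynomial σ ℂ) :
    F ∈ vanishingIdeal ℂ (dataLocus X Z) ↔ aeval (genericData f ξ τ) F = 0 := by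
  have h := mem_vanishingIdeal_condEDCorrespondence_iff hX hZX hc hg hf hz hze
    (rename Sum.inr F)
  rw [aeval_rename, Sum.elim_comp_inr] at h
  rw [← h, dataLocus, vanishingIdeal_zariskiClosure]
  constructor
  · intro hF p hp
    change eval p _ = 0
    rw [eval_rename]
    refine hF _ ⟨p ∘ Sum.inl, ?_⟩
    rwa [Sum.elim_comp_inl_inr]
  · rintro hF u ⟨x, hx⟩
    have h1 : eval (Sum.elim x u) (rename Sum.inr F) = 0 := hF _ hx
    rw [eval_rename, Sum.elim_comp_inr] at h1
    exact h1

theorem isPrime_of_mem_iff_aeval_eq_zero {ρ : Type} {I : Ideal (MvPolynomial ρ ℂ)} {y : ρ → L}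
    (h : ∀ F, F ∈ I ↔ aeval y F = 0) : I.IsPrime := by
  have : I = RingHom.ker (aeval y : MvPolynomial ρ ℂ →ₐ[ℂ] L) := by
    ext F
    rw [h, RingHom.mem_ker]
  rw [this]
  exact RingHom.ker_isPrime _

/-- Cramer's rule for the coefficients `τ` of a vector `d` in the span of the rows of a matrix. -/
theorem det_mul_eq_of_row_combination {R ι : Type*} [CommRing R] (J : Fin c → ι → R)
    (e : Fin c → ι) (τ : Fin c → R) (d : ι → R) (hd : ∀ i, d i = ∑ j, τ j * J j i) (j : Fin c) :
    (Matrix.of fun j k => J j (e k)).det * τ j =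
      ∑ k, d (e k) * (Matrix.of fun j k => J j (e k)).adjugate k j := by
  set G : Matrix (Fin c) (Fin c) R := Matrix.of fun j k => J j (e k) with hG
  have h1 : (fun k => d (e k)) = Matrix.vecMul τ G := by
    ext k
    rw [hd]
    rfl
  change _ = Matrix.vecMul (fun k => d (e k)) G.adjugate j
  rw [h1, Matrix.vecMul_vecMul, Matrix.mul_adjugate, Matrix.vecMul_smul, Matrix.vecMul_one]
  rfl

omit [Fintype σ] in
theorem aeval_jacobianMinor {R : Type*} [CommRing R] [Algebra ℂ R] (y : σ → R)
    (f : Fin c → MvPolynomial σ ℂ) (e : Fin c → σ) :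
    aeval y (jacobianMinor f e) = (Matrix.of fun j k => aeval y (pderiv (e k) (f j))).det :=
  map_jacobianMinor (aeval y : MvPolynomial σ ℂ →ₐ[ℂ] R).toRingHom f e

/-- The adjugate of the submatrix with columns `e` of the Jacobian matrix of `f`. -/
def jacobianAdjugate (f : Fin c → MvPolynomial σ ℂ) (e : Fin c → σ) :
    Matrix (Fin c) (Fin c) (MvPolynomial σ ℂ) :=
  (Matrix.of fun j k => pderiv (e k) (f j)).adjugate

omit [Fintype σ] in
theorem aeval_jacobianAdjugate {R : Type*} [CommRing R] [Algebra ℂ R] (y : σ → R)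
    (f : Fin c → MvPolynomial σ ℂ) (e : Fin c → σ) (k j : Fin c) :
    aeval y (jacobianAdjugate f e k j) =
      (Matrix.of fun j k => aeval y (pderiv (e k) (f j))).adjugate k j :=
  congrFun₂ (AlgHom.map_adjugate (aeval y : MvPolynomial σ ℂ →ₐ[ℂ] R)
    (Matrix.of fun j k => pderiv (e k) (f j))) k j

/-- Cramer's rule writes membership in the span as polynomial equations `F i` in `(x, u)`, after
clearing the minor. They hold at the generic point, hence on the closure. -/
theorem mem_condEDCorrespondence_iff (hX : IsIrreducibleVariety X) (hZ : IsIrreducibleVariety Z)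
    (hZX : Z ⊆ X)
    (hc : dim X + (c : WithBot ℕ∞) = ((Fintype.card σ : ℕ) : WithBot ℕ∞))
    {f : Fin c → MvPolynomial σ ℂ}
    (hf : ∀ j, f j ∈ vanishingIdeal ℂ X) {e : Fin c → σ} {x : σ → ℂ} (hx : x ∈ Z)
    (hxe : eval x (jacobianMinor f e) ≠ 0) (u : σ → ℂ) :
    Sum.elim x u ∈ condEDCorrespondence X Z ↔
      u - x ∈ Submodule.span ℂ (Set.range fun j => gradient (f j) x) := by
  constructor
  · intro h
    obtain ⟨L, _, _, ξ, τ, hg⟩ := exists_isGenericPoint hZ c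
    let δ (i : σ) : MvPolynomial (σ ⊕ σ) ℂ := .X (Sum.inr i) - .X (Sum.inl i)
    let F (i : σ) : MvPolynomial (σ ⊕ σ) ℂ := rename Sum.inl (jacobianMinor f e) * δ i -
      ∑ j, (∑ k, δ (e k) * rename Sum.inl (jacobianAdjugate f e k j)) * rename Sum.inl (pderiv i (f j))
    have hF (i : σ) : F i ∈ vanishingIdeal ℂ (condEDCorrespondence X Z) := by
      rw [mem_vanishingIdeal_condEDCorrespondence_iff hX hZX hc hg hf hx hxe]
      have hδ (i : σ) : aeval (Sum.elim ξ (genericData f ξ τ)) (δ i) =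
          ∑ j, τ j * aeval ξ (pderiv i (f j)) := by
        simp [δ, genericData]
      simp only [F, map_sub, map_mul, map_sum, aeval_rename, Sum.elim_comp_inl,
        aeval_jacobianAdjugate, aeval_jacobianMinor]
      rw [hδ, Finset.mul_sum, sub_eq_zero]
      refine Finset.sum_congr rfl fun j _ => ?_
      rw [← mul_assoc]
      congr 1
      simp_rw [hδ]
      exact det_mul_eq_of_row_combination (fun j i => aeval ξ (pderiv i (f j))) e τ
        (fun i => ∑ j, τ j * aeval ξ (pderiv i (f j))) (fun _ => rfl) j
    rw [Submodule.mem_span_range_iff_exists_fun]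
    refine ⟨fun j => (eval x (jacobianMinor f e))⁻¹ *
      ∑ k, (u (e k) - x (e k)) * eval x (jacobianAdjugate f e k j), ?_⟩
    ext i
    have hi : eval _ (F i) = 0 := hF i _ h
    simp only [F, δ, map_sub, map_mul, map_sum, eval_rename, Sum.elim_comp_inl, eval_X,
      Sum.elim_inl, Sum.elim_inr, sub_eq_zero] at hi
    rw [Pi.sub_apply, Finset.sum_apply]
    simp only [Pi.smul_apply, smul_eq_mul, gradient, mul_assoc]
    rw [← Finset.mul_sum, ← hi, inv_mul_cancel_left₀ hxe]
  · intro h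
    refine subset_zariskiClosure _ ⟨x, u, rfl,
      ⟨mem_smoothLocus_of_jacobianMinor hX hc (hZX hx) hf hxe, hx⟩, ?_⟩
    exact (mem_normalSpace_iff_of_jacobianMinor hX hc (hZX hx) hf hxe _).2 h

theorem isAffineBundleOver_condEDCorrespondence (hX : IsIrreducibleVariety X)
    (hZ : IsIrreducibleVariety Z) (hZX : Z ⊆ X)
    (hc : dim X + (c : WithBot ℕ∞) = ((Fintype.card σ : ℕ) : WithBot ℕ∞)) :
    IsAffineBundleOver (smoothLocus X ∩ Z) (condEDCorrespondence X Z) c := by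
  rintro z ⟨hzs, hzZ⟩
  obtain ⟨f, e, hf, hze⟩ := exists_chart hc hzs
  -- The offset is `x` itself, written as `x * h / h` with the minor `h` as common denominator.
  refine ⟨jacobianMinor f e, fun i => .X i * jacobianMinor f e, fun j i => pderiv i (f j), hze,
    fun x hx hxe => ⟨linearIndependent_gradient hxe, fun u => ?_⟩⟩
  rw [mem_condEDCorrespondence_iff hX hZ hZX hc hf hx.2 hxe]
  simp only [map_mul, eval_X, mul_div_cancel_right₀ _ hxe]
  rfl

end Correspondence

/-! ### Places of the function field and specializations. -/

section Specialization

variable {L : Type} [Field L] [Algebra ℂ L] {ρ κ : Type}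

theorem exists_algHom_adjoin (u : ρ → L) (w : ρ → ℂ)
    (h : ∀ F : MvPolynomial ρ ℂ, aeval u F = 0 → eval w F = 0) :
    ∃ ψ : Algebra.adjoin ℂ (Set.range u) →ₐ[ℂ] ℂ,
      ∀ (b : Algebra.adjoin ℂ (Set.range u)) (F : MvPolynomial ρ ℂ),
        (b : L) = aeval u F → ψ b = eval w F := by
  let e := (Subalgebra.equivOfEq _ _ (Algebra.adjoin_range_eq_range_aeval ℂ u)).trans
    (Ideal.quotientKerEquivRange (aeval u : MvPolynomial ρ ℂ →ₐ[ℂ] L)).symm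
  let l : (MvPolynomial ρ ℂ ⧸ RingHom.ker (aeval u : MvPolynomial ρ ℂ →ₐ[ℂ] L)) →ₐ[ℂ] ℂ :=
    Ideal.Quotient.liftₐ _ (aeval w) fun F hF => h F hF
  refine ⟨l.comp e.toAlgHom, fun b F hb => ?_⟩
  have : e b = Ideal.Quotient.mk _ F := by
    rw [AlgEquiv.trans_apply, AlgEquiv.symm_apply_eq]
    exact Subtype.ext hb
  change l (e b) = _
  rw [this]
  rfl

/-- A homomorphism to `ℂ` from a subring of `L` extends to a place of `L`. -/
theorem exists_valuationSubring_of_algHom {A : Type} [CommRing A] [Algebra ℂ A] (i : A →ₐ[ℂ] L)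
    (ψ : A →ₐ[ℂ] ℂ) (h : ∀ a, i a = 0 → ψ a = 0) :
    ∃ O : ValuationSubring L, (∀ a, O.valuation (i a) ≤ 1) ∧
      (∀ a, ψ a = 0 → O.valuation (i a) < 1) ∧ ∀ a, ψ a ≠ 0 → O.valuation (i a) = 1 := by
  let r : A →+* i.toRingHom.range := i.toRingHom.rangeRestrict
  have hI : Ideal.map r (RingHom.ker ψ) ≠ ⊤ := by
    rw [Ideal.ne_top_iff_one, Ideal.mem_map_iff_of_surjective r i.toRingHom.rangeRestrict_surjective]
    rintro ⟨a, ha, ha1⟩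
    have h1 : i (1 - a) = 0 := by
      rw [map_sub, map_one, sub_eq_zero]
      exact (congrArg Subtype.val ha1).symm
    have h2 := h _ h1
    rw [map_sub, RingHom.mem_ker.1 ha] at h2
    simp at h2
  obtain ⟨O, hO, hO1⟩ := Ideal.image_subset_nonunits_valuationSubring _ hI
  have hle (a : A) : O.valuation (i a) ≤ 1 := (O.valuation_le_one_iff _).2 (hO ⟨a, rfl⟩)
  have hlt (a : A) (ha : ψ a = 0) : O.valuation (i a) < 1 :=
    hO1 ⟨r a, Ideal.mem_map_of_mem r ha, rfl⟩
  -- If `i a` were a nonunit, then `a * (ψ a)⁻¹` and `a * (ψ a)⁻¹ - 1` would both map into the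
  -- maximal ideal, and so would `1`.
  refine ⟨O, hle, hlt, fun a ha => (hle a).antisymm (not_lt.1 fun hlt' => ?_)⟩
  have h1 := hlt (a * algebraMap ℂ A (ψ a)⁻¹ - 1) (by simp [ha])
  have h2 : O.valuation (i (a * algebraMap ℂ A (ψ a)⁻¹)) < 1 := by
    rw [map_mul, map_mul]
    exact mul_lt_one_of_lt_of_le hlt' (hle _)
  have h3 := O.valuation.map_sub_lt h2 h1
  rw [← map_sub] at h3
  simp at h3

/-- The polynomials whose value at `y` lies in the maximal ideal of a place. -/
def placeIdeal (O : ValuationSubring L) (y : κ → L)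
    (h : ∀ F : MvPolynomial κ ℂ, O.valuation (aeval y F) ≤ 1) : Ideal (MvPolynomial κ ℂ) where
  carrier := {F | O.valuation (aeval y F) < 1}
  add_mem' {a b} ha hb := by
    rw [Set.mem_ofPred_eq, map_add]
    exact O.valuation.map_add_lt ha hb
  zero_mem' := by simp
  smul_mem' a b hb := by
    rw [Set.mem_ofPred_eq, smul_eq_mul, map_mul, map_mul]
    rw [mul_comm]
    exact mul_lt_one_of_lt_of_le hb (h a)

theorem valuation_aeval_le_one {O : ValuationSubring L}
    (hO : ∀ a : ℂ, O.valuation (algebraMap ℂ L a) ≤ 1) {y : κ → L}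
    (hy : ∀ k, O.valuation (y k) ≤ 1) (F : MvPolynomial κ ℂ) : O.valuation (aeval y F) ≤ 1 := by
  induction F using MvPolynomial.induction_on with
  | C a => simpa using hO a
  | add p q hp hq =>
    rw [map_add]
    exact O.valuation.map_add_le hp hq
  | mul_X p k hp =>
    rw [map_mul, map_mul, aeval_X]
    exact mul_le_one' hp (hy k)

/-- The residue field may be larger than `ℂ`. The place still cuts out a proper ideal of
polynomials, and the Nullstellensatz gives a zero of it. -/
theorem exists_point_of_place [Finite κ] {O : ValuationSubring L}
    (hO : ∀ a : ℂ, O.valuation (algebraMap ℂ L a) ≤ 1) {y : κ → L}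
    (hy : ∀ k, O.valuation (y k) ≤ 1) :
    ∃ p : κ → ℂ, ∀ F : MvPolynomial κ ℂ, O.valuation (aeval y F) < 1 → eval p F = 0 := by
  let P := placeIdeal O y (valuation_aeval_le_one hO hy)
  have hP : P ≠ ⊤ := by
    rw [Ideal.ne_top_iff_one]
    intro h1
    have : O.valuation (aeval y (1 : MvPolynomial κ ℂ)) < 1 := h1
    simp at this
  obtain ⟨M, hM, hPM⟩ := Ideal.exists_le_maximal P hP
  obtain ⟨p, rfl⟩ := isMaximal_iff_eq_vanishingIdeal_singleton.1 hM
  exact ⟨p, fun F hF => hPM hF p rfl⟩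

theorem valuation_le_one_of_isIntegral {A L : Type*} [CommRing A] [Field L] [Algebra A L]
    {O : ValuationSubring L} (hA : ∀ a : A, O.valuation (algebraMap A L a) ≤ 1) {x : L}
    (hx : IsIntegral A x) : O.valuation x ≤ 1 := by
  have : IsIntegral O.toSubring x :=
    hx.map_of_comp_eq ((algebraMap A L).codRestrict O.toSubring
      fun a => (O.valuation_le_one_iff _).1 (hA a)) (RingHom.id L) rfl
  rw [← O.integer_valuation] at this
  exact Valuation.Integers.mem_of_integral (Valuation.integer.integers O.valuation) this

/-- This is the Nullstellensatz for the prime ideal of relations between the `u`. -/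
theorem exists_eval_ne_zero_of_aeval_ne_zero [Finite ρ] (u : ρ → L) {G : MvPolynomial ρ ℂ}
    (hG : aeval u G ≠ 0) :
    ∃ w : ρ → ℂ, eval w G ≠ 0 ∧ ∀ F : MvPolynomial ρ ℂ, aeval u F = 0 → eval w F = 0 := by
  by_contra! hcon
  have hp := RingHom.ker_isPrime (aeval u : MvPolynomial ρ ℂ →ₐ[ℂ] L)
  refine hG ((RingHom.mem_ker (f := (aeval u : MvPolynomial ρ ℂ →ₐ[ℂ] L))).1 ?_)
  rw [← IsPrime.vanishingIdeal_zeroLocus (K := ℂ) (RingHom.ker (aeval u : MvPolynomial ρ ℂ →ₐ[ℂ] L))]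
  intro w hw
  by_contra hne
  obtain ⟨F, hF, hF'⟩ := hcon w hne
  exact hF' (hw F hF)

theorem infinite_setOf_eval_update_ne_zero {s : Type} [DecidableEq s] {Q : MvPolynomial s ℂ}
    (hQ : Q ≠ 0) (k : s) : ∃ a : s → ℂ, {t : ℂ | eval (Function.update a k t) Q ≠ 0}.Infinite := by
  obtain ⟨a, ha⟩ : ∃ a, eval a Q ≠ 0 := by
    by_contra! h
    exact hQ (MvPolynomial.funext fun a => by rw [h a, map_zero])
  refine ⟨a, ?_⟩
  let q : Polynomial ℂ :=
    aeval (Function.update (fun i => Polynomial.C (a i)) k Polynomial.X) Q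
  have hq (t : ℂ) : q.eval t = eval (Function.update a k t) Q := by
    have : (Polynomial.aeval t).comp (aeval (Function.update (fun i => Polynomial.C (a i)) k
        Polynomial.X) : MvPolynomial s ℂ →ₐ[ℂ] Polynomial ℂ) = aeval (Function.update a k t) := by
      ext i
      by_cases hi : i = k
      · subst hi
        simp
      · simp [hi]
    exact DFunLike.congr_fun this Q
  have hq0 : q ≠ 0 := by
    intro h0
    have := hq (a k)
    rw [h0, Function.update_eq_self, Polynomial.eval_zero] at this
    exact ha this.symm
  have hfin : {t : ℂ | eval (Function.update a k t) Q = 0}.Finite := by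
    refine (q.roots.toFinset.finite_toSet).subset fun t ht => ?_
    have : q.IsRoot t := (hq t).trans ht
    simpa [hq0] using this
  exact hfin.infinite_compl

/-- If the coordinate `k` of a family `y` generating `L` is transcendental over the values of `u`,
then it takes infinitely many values on the fibre over some point of the locus of `u`, which may be
chosen in a given nonempty open subset. -/
theorem exists_infinite_fiber [Finite κ] [Finite ρ] (y : κ → L) (u : ρ → L)
    [hy : Algebra.IsAlgebraic (Algebra.adjoin ℂ (Set.range y)) L] (k : κ)
    (hk : Transcendental (Algebra.adjoin ℂ (Set.range u)) (y k))
    {G : MvPolynomial ρ ℂ} (hG : aeval u G ≠ 0) :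
    ∃ w : ρ → ℂ, eval w G ≠ 0 ∧ {t : ℂ | ∃ p : κ → ℂ, p k = t ∧
      ∀ F : MvPolynomial (κ ⊕ ρ) ℂ, aeval (Sum.elim y u) F = 0 →
        eval (Sum.elim p w) F = 0}.Infinite := by
  classical
  let B := Algebra.adjoin ℂ (Set.range u)
  have hBy : Algebra.IsAlgebraic (Algebra.adjoin B (Set.range y)) L := by
    have hle : Algebra.adjoin ℂ (Set.range y) ≤
        (Algebra.adjoin B (Set.range y)).restrictScalars ℂ :=
      Algebra.adjoin_le Algebra.subset_adjoin
    exact hy.ringHom_of_comp_eq (Subalgebra.inclusion hle).toRingHom (RingHom.id L)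
      (Subalgebra.inclusion_injective hle) Function.surjective_id rfl
  -- The chosen coordinate is completed by other coordinates to a transcendence basis of `L` over
  -- `ℂ[u]`. Each `y j` becomes integral over `B[s]` after multiplication by some nonzero `r j`,
  -- given by a polynomial `P j`.
  obtain ⟨s, hks, hsy, hs⟩ := exists_isTranscendenceBasis_between (R := B) {y k} (Set.range y)
    (by simp) (algebraicIndependent_unique_type_iff.2 hk)
  have : Finite s := (Set.finite_range y).subset hsy
  have hsalg : Algebra.IsAlgebraic (Algebra.adjoin B s) L := by
    have := hs.isAlgebraic
    rwa [Subtype.range_coe] at this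
  choose r hr0 hrint using fun j => (hsalg.isAlgebraic (y j)).exists_integral_multiple
  have hrange (a : Algebra.adjoin B s) : ∃ P : MvPolynomial s B, aeval (Subtype.val : s → L) P = a := by
    obtain ⟨a, ha⟩ := a
    rw [← Subtype.range_coe (s := s), Algebra.adjoin_range_eq_range_aeval] at ha
    exact ha
  choose P hP using fun j => hrange (r j)
  cases nonempty_fintype κ
  have hP0 : ∏ j, P j ≠ 0 := by
    refine Finset.prod_ne_zero_iff.2 fun j _ h0 => hr0 j (Subtype.ext ?_)
    rw [← hP j, h0, map_zero]
    rfl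
  obtain ⟨m, hm⟩ := ne_zero_iff.1 hP0
  -- `b` lifts a nonzero coefficient of `∏ P j`. Choosing `w` off the zeros of `b * G` keeps that
  -- product nonzero after `u` is specialized to `w`.
  obtain ⟨b, hb⟩ : ∃ b : MvPolynomial ρ ℂ, aeval u b = ((coeff m (∏ j, P j) : B) : L) := by
    have hc : ((coeff m (∏ j, P j) : B) : L) ∈ B := (coeff m (∏ j, P j)).2
    exact (SetLike.ext_iff.1 (Algebra.adjoin_range_eq_range_aeval ℂ u) _).1 hc
  have hbG : aeval u (b * G) ≠ 0 := by
    rw [map_mul, hb]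
    exact mul_ne_zero (fun h => hm (Subtype.ext h)) hG
  obtain ⟨w, hw, hwu⟩ := exists_eval_ne_zero_of_aeval_ne_zero u hbG
  rw [map_mul] at hw
  obtain ⟨ψw, hψw⟩ := exists_algHom_adjoin u w hwu
  let Q := map ψw.toRingHom (∏ j, P j)
  have hQ : Q ≠ 0 := by
    refine ne_zero_iff.2 ⟨m, ?_⟩
    rw [coeff_map]
    exact (hψw _ b hb.symm).trans_ne (left_ne_zero_of_mul hw)
  let k' : s := ⟨y k, hks rfl⟩
  obtain ⟨a, ha⟩ := infinite_setOf_eval_update_ne_zero hQ k'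
  refine ⟨w, right_ne_zero_of_mul hw, ha.mono fun t ht => ?_⟩
  let i : MvPolynomial s B →ₐ[ℂ] L := (aeval (R := B) (Subtype.val : s → L)).restrictScalars ℂ
  let ψ : MvPolynomial s B →ₐ[ℂ] ℂ := aevalTower ψw (Function.update a k' t)
  have hψP (j : κ) : ψ (P j) ≠ 0 := by
    have h1 : ψ (∏ j, P j) ≠ 0 := by
      have h2 : eval (Function.update a k' t) Q = ψ (∏ j, P j) := by
        rw [eval_map]
        rfl
      exact h2 ▸ ht
    rw [map_prod] at h1
    exact Finset.prod_ne_zero_iff.1 h1 j (Finset.mem_univ j)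
  -- The place sends `u` to `w`, the chosen coordinate to `t` and the rest of the basis to `a`. The
  -- `r j` are units there, so integrality makes every `y j` finite, and the place yields a point of
  -- the fibre.
  obtain ⟨O, hO, hO0, hO1⟩ := exists_valuationSubring_of_algHom i ψ fun a ha => by
    rw [show a = 0 from hs.1 (ha.trans (map_zero (aeval (R := B) (Subtype.val : s → L))).symm),
      map_zero]
  let u' (j : ρ) : B := ⟨u j, Algebra.subset_adjoin ⟨j, rfl⟩⟩
  have hiu (j : ρ) : i (C (u' j)) = u j := aeval_C _ _
  have hyO (j : κ) : O.valuation (y j) ≤ 1 := by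
    have h1 : O.valuation (r j • y j) ≤ 1 := by
      refine valuation_le_one_of_isIntegral (fun a => ?_) (hrint j)
      obtain ⟨p, hp⟩ := hrange a
      exact (congrArg O.valuation hp).symm.trans_le (hO p)
    have h2 : r j • y j = i (P j) * y j := by
      rw [Algebra.smul_def]
      exact congrArg (· * y j) (hP j).symm
    rwa [h2, map_mul, hO1 _ (hψP j), one_mul] at h1
  obtain ⟨p, hp⟩ := exists_point_of_place (y := Sum.elim y u)
    (fun a => by rw [← i.commutes]; exact hO _)
    (by
      rintro (j | j)
      · exact hyO j
      · exact (congrArg O.valuation (hiu j)).symm.trans_le (hO _))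
  have hpw : p ∘ Sum.inr = w := by
    ext j
    have h1 := hp (X (Sum.inr j) - C (w j)) (by
      have h2 := hO0 (C (u' j) - algebraMap ℂ _ (w j)) (by
        rw [map_sub, AlgHom.commutes, sub_eq_zero]
        exact (aevalTower_C _ _ _).trans ((hψw (u' j) (X j) (aeval_X u j).symm).trans (eval_X j)))
      rw [map_sub, i.commutes, hiu] at h2
      simpa using h2)
    simpa [sub_eq_zero] using h1
  have hpk : p (Sum.inl k) = t := by
    have h1 := hp (X (Sum.inl k) - C t) (by
      have h2 := hO0 (X k' - algebraMap ℂ _ t) (by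
        rw [map_sub, AlgHom.commutes, sub_eq_zero]
        exact (aevalTower_X _ _ _).trans (Function.update_self _ _ _))
      rw [map_sub, i.commutes, show i (X k') = y k from aeval_X _ _] at h2
      simpa using h2)
    simpa [sub_eq_zero] using h1
  refine ⟨p ∘ Sum.inl, hpk, fun F hF => ?_⟩
  rw [← hpw, Sum.elim_comp_inl_inr]
  exact hp F (by rw [hF, map_zero]; exact zero_lt_one)

end Specialization

/-! ### Irreducibility of the data locus and its dimension in the affine case. -/

section DataLocus

variable {σ : Type} [Fintype σ] {c : ℕ} {L : Type} [Field L] [Algebra ℂ L]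
  {X Z : Set (σ → ℂ)} {ξ : σ → L} {τ : Fin c → L} {f : Fin c → MvPolynomial σ ℂ} {e : Fin c → σ}

omit [Fintype σ] in
theorem aeval_mem_intermediateField {F : Type*} [Field F] [Algebra ℂ F] [Algebra F L]
    [IsScalarTower ℂ F L] {M : IntermediateField F L} (hξ : ∀ i, ξ i ∈ M)
    (p : MvPolynomial σ ℂ) : aeval ξ p ∈ M := by
  have hle : Algebra.adjoin ℂ (Set.range ξ) ≤ (M.restrictScalars ℂ).toSubalgebra := by
    refine Algebra.adjoin_le ?_
    rintro _ ⟨i, rfl⟩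
    exact hξ i
  refine hle ?_
  rw [Algebra.adjoin_range_eq_range_aeval]
  exact ⟨p, rfl⟩

-- Cramer's rule writes `τ` rationally in `ξ` and the data, so the relative algebraic closure
-- contains all generators of `L`.
omit [Fintype σ] in
theorem isAlgebraic_of_isAlgebraic_left (hg : IsGenericPoint Z ξ τ)
    (hJ : aeval ξ (jacobianMinor f e) ≠ 0)
    (hξ : ∀ i, IsAlgebraic (IntermediateField.adjoin ℂ (Set.range (genericData f ξ τ))) (ξ i)) :
    Algebra.IsAlgebraic (IntermediateField.adjoin ℂ (Set.range (genericData f ξ τ))) L := by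
  let F := IntermediateField.adjoin ℂ (Set.range (genericData f ξ τ))
  let M := algebraicClosure F L
  have hM (a : L) : a ∈ M ↔ IsAlgebraic F a := mem_algebraicClosure_iff
  have hξM (i : σ) : ξ i ∈ M := (hM _).2 (hξ i)
  have huM (i : σ) : genericData f ξ τ i ∈ M :=
    M.algebraMap_mem ⟨_, IntermediateField.subset_adjoin ℂ _ ⟨i, rfl⟩⟩
  have hτM (j : Fin c) : τ j ∈ M := by
    have h1 := det_mul_eq_of_row_combination (fun j i => aeval ξ (pderiv i (f j))) e τ
      (fun i => genericData f ξ τ i - ξ i) (fun i => by simp [genericData]) j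
    rw [← aeval_jacobianMinor] at h1
    rw [eq_div_of_mul_eq hJ ((mul_comm _ _).trans h1)]
    refine div_mem (sum_mem fun k _ => mul_mem (sub_mem (huM _) (hξM _)) ?_)
      (aeval_mem_intermediateField hξM _)
    rw [← aeval_jacobianAdjugate]
    exact aeval_mem_intermediateField hξM _
  have hle : IntermediateField.adjoin ℂ (Set.range ξ ∪ Set.range τ) ≤ M.restrictScalars ℂ := by
    rw [IntermediateField.adjoin_le_iff]
    rintro _ (⟨i, rfl⟩ | ⟨j, rfl⟩)
    · exact hξM i
    · exact hτM j
  rw [hg.adjoin_eq_top] at hle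
  exact ⟨fun a => (hM a).1 (hle IntermediateField.mem_top)⟩

omit [Fintype σ] in
theorem aeval_jacobianMinor_ne_zero (hg : IsGenericPoint Z ξ τ) {z : σ → ℂ} (hz : z ∈ Z)
    (hze : eval z (jacobianMinor f e) ≠ 0) : aeval ξ (jacobianMinor f e) ≠ 0 :=
  fun h => hze ((hg.aeval_left_eq_zero_iff _).1 h z hz)

theorem trdeg_adjoin_of_isAlgebraic (s : Set L) [Algebra.IsAlgebraic (Algebra.adjoin ℂ s) L] :
    Algebra.trdeg ℂ (Algebra.adjoin ℂ s) = Algebra.trdeg ℂ L := by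
  have : FaithfulSMul ℂ (Algebra.adjoin ℂ s) :=
    (faithfulSMul_iff_algebraMap_injective _ _).2 (algebraMap ℂ _).injective
  rw [← trdeg_add_eq ℂ (Algebra.adjoin ℂ s) (A := L), trdeg_eq_zero (A := L),
    add_zero]

theorem dim_dataLocus_of_isAlgebraic (hX : IsIrreducibleVariety X) (hZX : Z ⊆ X)
    (hc : dim X + (c : WithBot ℕ∞) = ((Fintype.card σ : ℕ) : WithBot ℕ∞))
    (hg : IsGenericPoint Z ξ τ) (hf : ∀ j, f j ∈ vanishingIdeal ℂ X) {z : σ → ℂ} (hz : z ∈ Z)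
    (hze : eval z (jacobianMinor f e) ≠ 0)
    (hξ : ∀ i, IsAlgebraic (IntermediateField.adjoin ℂ (Set.range (genericData f ξ τ))) (ξ i)) :
    dim (dataLocus X Z) = dim Z + (c : WithBot ℕ∞) := by
  have := isAlgebraic_algebraAdjoin
    (isAlgebraic_of_isAlgebraic_left hg (aeval_jacobianMinor_ne_zero hg hz hze) hξ)
  rw [hg.dim_add, dim_eq_trdeg_adjoin (genericData f ξ τ),
    trdeg_adjoin_of_isAlgebraic]
  ext F
  exact mem_vanishingIdeal_dataLocus_iff hX hZX hc hg hf hz hze F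

theorem isIrreducibleVariety_dataLocus (hX : IsIrreducibleVariety X)
    (hZ : IsIrreducibleVariety Z) (hZX : Z ⊆ X)
    (hc : dim X + (c : WithBot ℕ∞) = ((Fintype.card σ : ℕ) : WithBot ℕ∞))
    (hs : ¬ Z ⊆ singularLocus X) : IsIrreducibleVariety (dataLocus X Z) := by
  obtain ⟨z, hz, hzs⟩ := Set.not_subset.1 hs
  obtain ⟨f, e, hf, hze⟩ := exists_chart hc (by_contra fun h => hzs ⟨hZX hz, h⟩)
  obtain ⟨L, _, _, ξ, τ, hg⟩ := exists_isGenericPoint hZ c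
  exact isIrreducibleVariety_of_isPrime (isZariskiClosed_zariskiClosure _)
    (isPrime_of_mem_iff_aeval_eq_zero
      (mem_vanishingIdeal_dataLocus_iff hX hZX hc hg hf hz hze))

theorem isAlgebraic_intermediateField_of_adjoin {s : Set L} {a : L}
    (h : IsAlgebraic (Algebra.adjoin ℂ s) a) : IsAlgebraic (IntermediateField.adjoin ℂ s) a :=
  h.ringHom_of_comp_eq
    (Subalgebra.inclusion (IntermediateField.algebra_adjoin_le_adjoin ℂ s)).toRingHom
    (RingHom.id L) (Subalgebra.inclusion_injective _) rfl

theorem condEDCorrespondence_subset : condEDCorrespondence X Z ⊆ edCorrespondence X := by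
  refine zariskiClosure_subset (isZariskiClosed_zariskiClosure _) ?_
  rintro _ ⟨x, u, rfl, hx, hu⟩
  exact subset_zariskiClosure _ ⟨x, u, rfl, hx.1, hu⟩

theorem dim_dataLocus_of_isEDRegular (hX : IsIrreducibleVariety X)
    (hZ : IsIrreducibleVariety Z) (hZX : Z ⊆ X)
    (hc : dim X + (c : WithBot ℕ∞) = ((Fintype.card σ : ℕ) : WithBot ℕ∞))
    (hreg : IsEDRegular X Z) : dim (dataLocus X Z) = dim Z + (c : WithBot ℕ∞) := by
  obtain ⟨hs, U, ⟨I, hI⟩, -, hfin, hU⟩ := hreg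
  obtain ⟨z, hz, hzs⟩ := Set.not_subset.1 hs
  obtain ⟨f, e, hf, hze⟩ := exists_chart hc (by_contra fun h => hzs ⟨hZX hz, h⟩)
  obtain ⟨L, _, _, ξ, τ, hg⟩ := exists_isGenericPoint hZ c
  refine dim_dataLocus_of_isAlgebraic hX hZX hc hg hf hz hze fun i => by_contra fun hi => ?_
  have htr : Transcendental (Algebra.adjoin ℂ (Set.range (genericData f ξ τ))) (ξ i) :=
    fun h => hi (isAlgebraic_intermediateField_of_adjoin h)
  obtain ⟨u, hu, huU⟩ := Set.not_subset.1 hU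
  rw [hI, mem_zeroLocus_iff] at huU
  push Not at huU
  obtain ⟨G, hGI, hGu⟩ := huU
  -- `G` vanishes off `U` but not on the whole data locus, so it is nonzero at the generic data
  -- point; the fibre found below then lies over a point of `U`.
  have hG : aeval (genericData f ξ τ) G ≠ 0 := fun h =>
    hGu ((mem_vanishingIdeal_dataLocus_iff hX hZX hc hg hf hz hze G).2 h u hu)
  have hy : Algebra.IsAlgebraic (Algebra.adjoin ℂ (Set.range (Sum.elim ξ τ))) L := by
    apply isAlgebraic_algebraAdjoin
    rw [Set.Sum.elim_range, hg.adjoin_eq_top]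
    infer_instance
  obtain ⟨w, hw, hinf⟩ := exists_infinite_fiber (Sum.elim ξ τ) (genericData f ξ τ) (Sum.inl i) htr hG
  have hwU : w ∈ U := by
    by_contra h
    have : w ∈ Uᶜ := h
    rw [hI] at this
    exact hw (this G hGI)
  refine hinf (((hfin w hwU).image fun p => p i).subset ?_)
  rintro t ⟨p, hpt, hp⟩
  refine ⟨p ∘ Sum.inl, condEDCorrespondence_subset (Z := Z) ?_, hpt⟩
  have hcl : IsZariskiClosed (condEDCorrespondence X Z) := isZariskiClosed_zariskiClosure _
  rw [← hcl.zeroLocus_vanishingIdeal]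
  intro F hF
  rw [mem_vanishingIdeal_condEDCorrespondence_iff hX hZX hc hg hf hz hze] at hF
  -- The `τ`-coordinates of `p` are dropped; its `x`-part and `w` still satisfy all equations of the
  -- correspondence.
  have h1 := hp (rename (Sum.map Sum.inl id) F) (by
    rw [aeval_rename, ← hF]
    congr 2
    ext (k | k) <;> rfl)
  rw [eval_rename] at h1
  rw [← h1]
  change eval _ F = eval _ F
  congr 2
  ext (k | k) <;> rfl

theorem exists_codim {X : Set (σ → ℂ)} (hX : IsIrreducibleVariety X) :
    ∃ c : ℕ, dim X + (c : WithBot ℕ∞) = ((Fintype.card σ : ℕ) : WithBot ℕ∞) := by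
  have := hX.isPrime_vanishingIdeal
  have h := dim_le_card X
  rw [dim, ringKrullDim_eq_trdeg] at h ⊢
  refine ⟨Fintype.card σ - Cardinal.toNat (Algebra.trdeg ℂ (CoordRing X)), ?_⟩
  norm_cast at h ⊢
  exact Nat.add_sub_cancel' h

end DataLocus

/-! ### Euler's relation. -/

section Cone

variable {σ : Type} [Fintype σ] {X : Set (σ → ℂ)}

/-- Euler's relation on a cone. -/
theorem sum_mul_eval_pderiv_eq_zero_of_isCone (hX : IsCone X) {x : σ → ℂ} (hx : x ∈ X)
    {f : MvPolynomial σ ℂ} (hf : f ∈ vanishingIdeal ℂ X) :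
    ∑ i, x i * eval x (pderiv i f) = 0 := by
  let y (i : σ) : Polynomial ℂ := Polynomial.C (x i) * Polynomial.X
  have hy (a : ℂ) (g : MvPolynomial σ ℂ) : (aeval y g).eval a = eval (a • x) g := by
    have : (Polynomial.aeval a).comp (aeval y : MvPolynomial σ ℂ →ₐ[ℂ] Polynomial ℂ) =
        aeval (a • x) := by
      ext i
      simp only [AlgHom.comp_apply, aeval_X, y, map_mul, Polynomial.aeval_C, Polynomial.aeval_X,
        Pi.smul_apply, smul_eq_mul]
      exact mul_comm _ _
    exact DFunLike.congr_fun this g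
  -- `f` need not be homogeneous: its restriction to the line `t • x` is the zero polynomial, and
  -- the relation is its derivative at `t = 1`.
  have h0 : aeval y f = 0 := Polynomial.funext fun a => by
    rw [hy, Polynomial.eval_zero]
    exact hf _ (hX x hx a)
  have h1 := derivation_aeval Polynomial.derivative' y f
  rw [h0, map_zero] at h1
  have h2 := congrArg (Polynomial.eval 1) h1
  rw [Polynomial.eval_zero, Polynomial.eval_finsetSum] at h2
  rw [h2]
  refine Finset.sum_congr rfl fun i _ => ?_
  rw [smul_eq_mul, Polynomial.eval_mul, hy, one_smul, mul_comm]
  congr 1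
  simp [y]

end Cone

/-! ### Equations of the projective ED correspondence. -/

section Homogeneous

theorem aeval_pow_mul_of_isWeightedHomogeneous {κ R : Type*} [CommRing R] [Algebra ℂ R]
    {w : κ → ℕ} {k : ℕ} {F : MvPolynomial κ ℂ} (hF : IsWeightedHomogeneous w F k) (a : R)
    (y : κ → R) : aeval (fun i => a ^ w i * y i) F = a ^ k * aeval y F := by
  induction hF using IsWeightedHomogeneous.induction_on with
  | zero => simp
  | add p q _ _ hp hq => rw [map_add, map_add, hp, hq, mul_add]
  | monomial d r hr =>
    rw [aeval_monomial, aeval_monomial, ← hr, Finsupp.weight_apply, Finsupp.prod, Finsupp.prod,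
      Finsupp.sum, ← Finset.prod_pow_eq_pow_sum]
    simp only [mul_pow, Finset.prod_mul_distrib, smul_eq_mul, ← pow_mul]
    rw [mul_left_comm]
    simp only [mul_comm]

variable {σ : Type}

theorem aeval_smul_of_isWeightedHomogeneous {R : Type*} [CommRing R] [Algebra ℂ R] {k : ℕ}
    {F : MvPolynomial (σ ⊕ σ) ℂ}
    (hF : IsWeightedHomogeneous (Sum.elim (fun _ => 1) (fun _ => 0) : σ ⊕ σ → ℕ) F k) (a : R)
    (y u : σ → R) : aeval (Sum.elim (a • y) u) F = a ^ k * aeval (Sum.elim y u) F := by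
  rw [← aeval_pow_mul_of_isWeightedHomogeneous hF]
  congr 2
  ext (i | i) <;> simp

variable [Fintype σ]

/-- The polynomials, homogeneous in `x`, that vanish on the pairs `(x, u)`, `x ≠ 0`, of the ED
correspondence. -/
def projForms (X : Set (σ → ℂ)) : Set (MvPolynomial (σ ⊕ σ) ℂ) :=
  {F | (∃ k, IsWeightedHomogeneous (Sum.elim (fun _ => 1) (fun _ => 0) : σ ⊕ σ → ℕ) F k) ∧
    ∀ x u : σ → ℂ, x ≠ 0 → Sum.elim x u ∈ edCorrespondence X → eval (Sum.elim x u) F = 0}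

/-- Every defining form of a closed set containing the image belongs to `projForms X`: a change of
representative only multiplies its value by a nonzero power. -/
theorem mk_mem_projEDCorrespondence {X : Set (σ → ℂ)} {x u : σ → ℂ} (hx : x ≠ 0)
    (h : ∀ F ∈ projForms X, eval (Sum.elim x u) F = 0) :
    (Projectivization.mk ℂ x hx, u) ∈ projEDCorrespondence X := by
  rintro _ ⟨⟨S, hS, rfl⟩, hA⟩ F hF
  obtain ⟨k, hk⟩ := hS F hF
  have hrep (y v : σ → ℂ) (hy : y ≠ 0) : ∃ a : ℂ, a ≠ 0 ∧
      eval (Sum.elim (Projectivization.mk ℂ y hy).rep v) F = a ^ k * eval (Sum.elim y v) F := by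
    obtain ⟨a, ha⟩ := Projectivization.exists_smul_eq_mk_rep ℂ y hy
    refine ⟨a, a.ne_zero, ?_⟩
    rw [← ha]
    exact aeval_smul_of_isWeightedHomogeneous hk (a : ℂ) y v
  obtain ⟨a, -, ha⟩ := hrep x u hx
  refine ha.trans ?_
  rw [h F ⟨⟨k, hk⟩, fun y v hy hyv => ?_⟩, mul_zero]
  have h1 := hA (a := (Projectivization.mk ℂ y hy, v)) ⟨y, hy, hyv, rfl⟩ F hF
  obtain ⟨b, hb, hb'⟩ := hrep y v hy
  exact (mul_eq_zero.1 (hb'.symm.trans h1)).resolve_left (pow_ne_zero k hb)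

/-- Substitution of the data point `u` in a polynomial in `(x, u)`. -/
def specializeData (u : σ → ℂ) : MvPolynomial (σ ⊕ σ) ℂ →ₐ[ℂ] MvPolynomial σ ℂ :=
  aeval (Sum.elim X fun i => C (u i))

/-- The linear form with coefficients `a`. -/
def linearForm (a : σ → ℂ) : MvPolynomial σ ℂ := ∑ i, C (a i) * X i

/-- The ideal of the points of a hyperplane that are critical for `u`. -/
def hyperplaneCritIdeal (X : Set (σ → ℂ)) (u a : σ → ℂ) : Ideal (MvPolynomial σ ℂ) :=
  Ideal.span (insert (linearForm a) (specializeData u '' projForms X))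

omit [Fintype σ] in
theorem eval_specializeData (u x : σ → ℂ) (F : MvPolynomial (σ ⊕ σ) ℂ) :
    eval x (specializeData u F) = eval (Sum.elim x u) F := by
  have : (aeval x).comp (specializeData u) = aeval (R := ℂ) (Sum.elim x u) := by
    ext (i | i) <;> simp [specializeData]
  exact DFunLike.congr_fun this F

/-- A finite set of projective critical points avoids some hyperplane. -/
theorem exists_X_mem_radical_hyperplaneCritIdeal {X : Set (σ → ℂ)} {u : σ → ℂ}
    (h : {y : Projectivization ℂ (σ → ℂ) | (y, u) ∈ projEDCorrespondence X}.Finite) :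
    ∃ a : σ → ℂ, ∀ i, MvPolynomial.X i ∈ (hyperplaneCritIdeal X u a).radical := by
  classical
  have := h.to_subtype
  -- Some linear form is nonzero at all the finitely many representatives. With this form added, the
  -- equations have at most the zero `0`, and the Nullstellensatz applies.
  obtain ⟨φ, hφ⟩ := Module.exists_dual_forall_apply_ne_zero (K := ℂ)
    (fun y : {y : Projectivization ℂ (σ → ℂ) | (y, u) ∈ projEDCorrespondence X} => y.1.rep)
    fun y => y.1.rep_nonzero
  have hφ' (x : σ → ℂ) : φ x = ∑ i, φ (Pi.single i 1) * x i := by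
    conv_lhs => rw [pi_eq_sum_univ' x]
    simp [mul_comm]
  refine ⟨fun i => φ (Pi.single i 1), fun i => ?_⟩
  rw [← vanishingIdeal_zeroLocus_eq_radical (K := ℂ)]
  intro x hx
  suffices hx0 : x = 0 by simp [hx0]
  by_contra hx0
  have hmem := mk_mem_projEDCorrespondence (X := X) (u := u) hx0 fun F hF => by
    rw [← eval_specializeData]
    exact hx _ (Ideal.subset_span (Set.mem_insert_of_mem _ ⟨F, hF, rfl⟩))
  apply hφ ⟨_, hmem⟩
  obtain ⟨a, ha⟩ := Projectivization.exists_smul_eq_mk_rep ℂ x hx0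
  have hl := hx _ (Ideal.subset_span (Set.mem_insert _ _))
  have h0 : φ x = 0 := by
    rw [hφ', ← hl]
    simp [linearForm]
  change φ (Projectivization.mk ℂ x hx0).rep = 0
  rw [← ha, Units.smul_def, map_smul, h0, smul_zero]

end Homogeneous

/-! ### Finiteness of critical points at places over a good data point. -/

section Place

variable {σ : Type} [Fintype σ] {L : Type} [Field L] [Algebra ℂ L] {X : Set (σ → ℂ)}

/-- This is properness of projective space. Scale `ξ` to `w` by a coordinate `m` of maximal
valuation, so that `w m = 1`. If `l w` reduced to zero, all generators of `hyperplaneCritIdeal X u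
a` would, hence also a power of `w m`. -/
theorem valuation_div_linearForm_le_one {O : ValuationSubring L}
    (hO : ∀ a : ℂ, O.valuation (algebraMap ℂ L a) ≤ 1) {ξ v : σ → L} {u a : σ → ℂ}
    (hv : ∀ i, O.valuation (v i - algebraMap ℂ L (u i)) < 1) (hξ : ξ ≠ 0)
    (hF : ∀ F ∈ projForms X, aeval (Sum.elim ξ v) F = 0)
    (ha : ∀ i, MvPolynomial.X i ∈ (hyperplaneCritIdeal X u a).radical) :
    aeval ξ (linearForm a) ≠ 0 ∧ ∀ i, O.valuation (ξ i / aeval ξ (linearForm a)) ≤ 1 := by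
  obtain ⟨i₀, hi₀⟩ := Function.ne_iff.1 hξ
  have : Nonempty σ := ⟨i₀⟩
  obtain ⟨m, hm⟩ := Finite.exists_max fun i => O.valuation (ξ i)
  have hm0 : ξ m ≠ 0 := fun h0 => hi₀ (by simpa [h0] using hm i₀)
  let w : σ → L := (ξ m)⁻¹ • ξ
  have hw (i : σ) : O.valuation (w i) ≤ 1 := by
    change O.valuation ((ξ m)⁻¹ * ξ i) ≤ 1
    rw [mul_comm, ← div_eq_mul_inv, map_div₀]
    exact div_le_one_of_le₀ (hm i) zero_le
  have hwm : w m = 1 := inv_mul_cancel₀ hm0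
  have hv1 (i : σ) : O.valuation (v i) ≤ 1 := by
    rw [← sub_add_cancel (v i) (algebraMap ℂ L (u i))]
    exact O.valuation.map_add_le (hv i).le (hO _)
  let P := placeIdeal O (Sum.elim w v) (valuation_aeval_le_one hO (by
    rintro (i | i)
    · exact hw i
    · exact hv1 i))
  have hP (F : MvPolynomial (σ ⊕ σ) ℂ) :
      F ∈ P ↔ O.valuation (aeval (Sum.elim w v) F) < 1 := Iff.rfl
  -- Modulo the ideal of the place, `v` may be replaced by the constants `u`.
  have hspec (F : MvPolynomial (σ ⊕ σ) ℂ) :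
      rename Sum.inl (specializeData u F) ∈ P ↔ F ∈ P := by
    have h : ((Ideal.Quotient.mkₐ ℂ P).comp (rename Sum.inl)).comp (specializeData u) =
        Ideal.Quotient.mkₐ ℂ P := by
      ext (i | i)
      · simp [specializeData]
      · have : C (u i) - MvPolynomial.X (Sum.inr i) ∈ P := by
          rw [hP, ← O.valuation.map_neg]
          simpa using hv i
        simpa [specializeData] using (Ideal.Quotient.mk_eq_mk_iff_sub_mem _ _).2 this
    have := DFunLike.congr_fun h F
    rw [← Ideal.Quotient.eq_zero_iff_mem, ← Ideal.Quotient.eq_zero_iff_mem (a := F)]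
    exact Eq.congr_left this
  have hl : 1 ≤ O.valuation (aeval w (linearForm a)) := by
    by_contra! hlt
    have hle : hyperplaneCritIdeal X u a ≤ P.comap (rename Sum.inl) := by
      refine Ideal.span_le.2 (Set.insert_subset ?_ ?_)
      · rw [SetLike.mem_coe, Ideal.mem_comap, hP, aeval_rename]
        exact hlt
      · rintro _ ⟨F, hFX, rfl⟩
        rw [SetLike.mem_coe, Ideal.mem_comap, hspec, hP]
        obtain ⟨k, hk⟩ := hFX.1
        rw [aeval_smul_of_isWeightedHomogeneous hk, hF F hFX]
        simp
    obtain ⟨k, hk⟩ := ha m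
    have h1 := hle hk
    rw [Ideal.mem_comap, hP, aeval_rename] at h1
    simp [hwm] at h1
  have hlw : aeval ξ (linearForm a) = ξ m * aeval w (linearForm a) := by
    simp only [linearForm, map_sum, map_mul, aeval_X, aeval_C, Finset.mul_sum, w,
      Pi.smul_apply, smul_eq_mul]
    refine Finset.sum_congr rfl fun i _ => ?_
    field_simp
  have hl0 : aeval w (linearForm a) ≠ 0 := fun h0 => by simp [h0] at hl
  refine ⟨hlw ▸ mul_ne_zero hm0 hl0, fun i => ?_⟩
  have : ξ i / aeval ξ (linearForm a) = w i / aeval w (linearForm a) := by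
    rw [hlw]
    simp only [w, Pi.smul_apply, smul_eq_mul]
    field_simp
  rw [this, map_div₀]
  exact div_le_one_of_le₀ ((hw i).trans hl) zero_le

/-- A critical point for the data `v` is algebraic over `v` once it is scaled to lie on an affine
hyperplane that avoids the critical points for a specialization `u` of `v`. -/
theorem isAlgebraic_div_linearForm {ξ v : σ → L} {u a : σ → ℂ}
    (hv : ∀ F : MvPolynomial σ ℂ, aeval v F = 0 → eval u F = 0) (hξ : ξ ≠ 0)
    (hF : ∀ F ∈ projForms X, aeval (Sum.elim ξ v) F = 0)
    (ha : ∀ i, MvPolynomial.X i ∈ (hyperplaneCritIdeal X u a).radical) :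
    aeval ξ (linearForm a) ≠ 0 ∧
      ∀ i, IsAlgebraic (Algebra.adjoin ℂ (Set.range v)) (ξ i / aeval ξ (linearForm a)) := by
  constructor
  · obtain ⟨O, hO, hO0, -⟩ := exists_valuationSubring_of_algHom
      (aeval v : MvPolynomial σ ℂ →ₐ[ℂ] L) (aeval u) hv
    refine (valuation_div_linearForm_le_one (O := O) (fun b => ?_) (fun i => ?_) hξ hF ha).1
    · simpa using hO (C b)
    · have h := hO0 (MvPolynomial.X i - C (u i)) (by simp)
      rwa [map_sub, aeval_X, aeval_C] at h
  · intro i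
    by_contra hi
    set η := ξ i / aeval ξ (linearForm a) with hη
    let B := Algebra.adjoin ℂ (Set.range v)
    obtain ⟨ψ, hψ⟩ := exists_algHom_adjoin v u hv
    let j : Polynomial B →ₐ[ℂ] L := (Polynomial.aeval (R := B) η⁻¹).restrictScalars ℂ
    let ψ' : Polynomial B →ₐ[ℂ] ℂ := ψ.comp ((Polynomial.aeval (R := B) (0 : B)).restrictScalars ℂ)
    -- If `η` is transcendental over `B`, so is `η⁻¹`, and the specialization `v ↦ u` extends by
    -- `η⁻¹ ↦ 0`. The resulting place is a pole of `η`, against the bound.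
    have hηt : Transcendental B η⁻¹ := fun h => hi (IsAlgebraic.inv_iff.1 h)
    have hη0 : η ≠ 0 := fun h0 => hi (h0 ▸ isAlgebraic_zero)
    obtain ⟨O, hO, hO0, -⟩ := exists_valuationSubring_of_algHom j ψ' fun p hp => by
      rw [(transcendental_iff.1 hηt) p hp, map_zero]
    let v' (k : σ) : B := ⟨v k, Algebra.subset_adjoin ⟨k, rfl⟩⟩
    have h1 := (valuation_div_linearForm_le_one (O := O) (v := v)
      (fun b => by rw [← j.commutes]; exact hO _) (fun k => by
        have hjk : j (Polynomial.C (v' k)) = v k := Polynomial.aeval_C _ _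
        have h2 := hO0 (Polynomial.C (v' k) - algebraMap ℂ _ (u k)) (by
          rw [map_sub, AlgHom.commutes, sub_eq_zero]
          refine (congrArg ψ (Polynomial.aeval_C (0 : B) (v' k))).trans ?_
          exact (hψ (v' k) (MvPolynomial.X k) (aeval_X v k).symm).trans (eval_X k))
        rwa [map_sub, j.commutes, hjk] at h2) hξ hF ha).2 i
    have h2 := hO0 Polynomial.X (by
      refine (congrArg ψ (Polynomial.aeval_X (0 : B))).trans (map_zero ψ))
    rw [show j Polynomial.X = η⁻¹ from Polynomial.aeval_X _, map_inv₀] at h2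
    exact absurd (mul_lt_one_of_lt_of_le h2 h1) (by
      rw [inv_mul_cancel₀ ((Valuation.ne_zero_iff _).2 hη0)]
      exact lt_irrefl _)

end Place

/-! ### The dimension of the data locus in the projective case. -/

section ProjDataLocus

variable {σ : Type} [Fintype σ] {c : ℕ} {L : Type} [Field L] [Algebra ℂ L]
  {X Z : Set (σ → ℂ)} {ξ : σ → L} {τ : Fin c → L} {f : Fin c → MvPolynomial σ ℂ} {e : Fin c → σ}

/-- The quadratic form `q` as a polynomial. -/
def quadric (σ : Type) [Fintype σ] : MvPolynomial σ ℂ := ∑ i, MvPolynomial.X i ^ 2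

theorem aeval_projForms_eq_zero (hX : IsIrreducibleVariety X) (hZ : IsIrreducibleVariety Z)
    (hZX : Z ⊆ X) (hc : dim X + (c : WithBot ℕ∞) = ((Fintype.card σ : ℕ) : WithBot ℕ∞))
    (hg : IsGenericPoint Z ξ τ) (hf : ∀ j, f j ∈ vanishingIdeal ℂ X) {z : σ → ℂ} (hz : z ∈ Z)
    (hze : eval z (jacobianMinor f e) ≠ 0) (hz0 : z ∉ isotropicQuadric)
    {F : MvPolynomial (σ ⊕ σ) ℂ} (hF : F ∈ projForms X) :
    aeval (Sum.elim ξ (genericData f ξ τ)) F = 0 := by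
  rw [← aeval_pullback]
  -- The factor `quadric σ` excludes `x = 0`, where nothing is known about the forms.
  refine hg.aeval_eq_zero_of_forall (w := jacobianMinor f e * quadric σ) hz ?_ _ fun x hx hxw s => ?_
  · rw [map_mul]
    refine mul_ne_zero hze ?_
    simpa [quadric, isotropicQuadric] using hz0
  rw [map_mul] at hxw
  rw [eval_pullback]
  refine hF.2 _ _ ?_ (condEDCorrespondence_subset (Z := Z) ?_)
  · rintro rfl
    exact right_ne_zero_of_mul hxw (by simp [quadric])
  rw [mem_condEDCorrespondence_iff hX hZ hZX hc hf hx (left_ne_zero_of_mul hxw), add_sub_cancel_left]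
  exact Submodule.sum_mem _ fun j _ => Submodule.smul_mem _ _ (Submodule.subset_span ⟨j, rfl⟩)

/-- On a cone the tangent space contains the point itself, so `u - ξ` is orthogonal to `ξ`. This
relation fixes the scale that projective data forget. -/
theorem sum_genericData_mul_eq (hXc : IsCone X) (hZX : Z ⊆ X) (hg : IsGenericPoint Z ξ τ)
    (hf : ∀ j, f j ∈ vanishingIdeal ℂ X) :
    ∑ i, genericData f ξ τ i * ξ i = aeval ξ (quadric σ) := by
  have h (j : Fin c) : ∑ i, ξ i * aeval ξ (pderiv i (f j)) = 0 := by
    have : aeval ξ (∑ i, MvPolynomial.X i * pderiv i (f j)) = 0 := by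
      rw [hg.aeval_left_eq_zero_iff]
      intro x hx
      simpa using sum_mul_eval_pderiv_eq_zero_of_isCone hXc (hZX hx) (hf j)
    simpa using this
  simp only [genericData, add_mul, Finset.sum_add_distrib, Finset.sum_mul, quadric, map_sum,
    aeval_X, sq, map_mul]
  rw [Finset.sum_comm (s := Finset.univ (α := σ)), add_eq_left]
  refine Finset.sum_eq_zero fun j _ => ?_
  rw [← mul_zero (τ j), ← h j, Finset.mul_sum]
  exact Finset.sum_congr rfl fun i _ => by ring

theorem dim_dataLocus_of_isProjEDRegular (hX : IsIrreducibleVariety X)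
    (hZ : IsIrreducibleVariety Z) (hZX : Z ⊆ X) (hXc : IsCone X)
    (hc : dim X + (c : WithBot ℕ∞) = ((Fintype.card σ : ℕ) : WithBot ℕ∞))
    (hreg : IsProjEDRegular X Z) : dim (dataLocus X Z) = dim Z + (c : WithBot ℕ∞) := by
  obtain ⟨hs, hfin⟩ := hreg
  obtain ⟨z, hz, hzs⟩ := Set.not_subset.1 hs
  rw [Set.mem_union, not_or] at hzs
  obtain ⟨f, e, hf, hze⟩ := exists_chart hc (by_contra fun h => hzs.1 ⟨hZX hz, h⟩)
  obtain ⟨u, hu, hufin⟩ := Set.not_subset.1 hfin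
  obtain ⟨a, ha⟩ := exists_X_mem_radical_hyperplaneCritIdeal (Set.not_infinite.1 hufin)
  obtain ⟨L, _, _, ξ, τ, hg⟩ := exists_isGenericPoint hZ c
  refine dim_dataLocus_of_isAlgebraic hX hZX hc hg hf hz hze ?_
  have hq : aeval ξ (quadric σ) ≠ 0 := fun h0 =>
    hzs.2 (by simpa [quadric, isotropicQuadric] using (hg.aeval_left_eq_zero_iff _).1 h0 z hz)
  have hξ0 : ξ ≠ 0 := by
    rintro rfl
    exact hq (by simp [quadric])
  obtain ⟨hl, hη⟩ := isAlgebraic_div_linearForm (v := genericData f ξ τ)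
    (fun F hF0 => (mem_vanishingIdeal_dataLocus_iff hX hZX hc hg hf hz hze F).2 hF0 u hu) hξ0
    (fun F hF => aeval_projForms_eq_zero hX hZ hZX hc hg hf hz hze hzs.2 hF) ha
  set l := aeval ξ (linearForm a)
  let K := IntermediateField.adjoin ℂ (Set.range (genericData f ξ τ))
  let M := algebraicClosure K L
  have hM (x : L) : x ∈ M ↔ IsAlgebraic K x := mem_algebraicClosure_iff
  have hηM (i : σ) : ξ i / l ∈ M := (hM _).2 (isAlgebraic_intermediateField_of_adjoin (hη i))
  have huM (i : σ) : genericData f ξ τ i ∈ M :=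
    M.algebraMap_mem ⟨_, IntermediateField.subset_adjoin ℂ _ ⟨i, rfl⟩⟩
  have hqη : aeval ξ (quadric σ) = l ^ 2 * ∑ i, (ξ i / l) ^ 2 := by
    simp only [quadric, map_sum, map_pow, aeval_X, Finset.mul_sum]
    exact Finset.sum_congr rfl fun i _ => by field_simp
  -- With `η = ξ / l`, the relation `⟨u, ξ⟩ = q ξ` reads `l * ⟨u, η⟩ = l ^ 2 * q η`, so `l = ⟨u, η⟩
  -- / q η`, which is algebraic over the data.
  have hlM : l ∈ M := by
    have h1 : l * ∑ i, genericData f ξ τ i * (ξ i / l) = l * (l * ∑ i, (ξ i / l) ^ 2) := by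
      rw [← mul_assoc l l, ← sq, ← hqη, ← sum_genericData_mul_eq hXc hZX hg hf, Finset.mul_sum]
      exact Finset.sum_congr rfl fun i _ => by field_simp
    have h2 : ∑ i, (ξ i / l) ^ 2 ≠ 0 := fun h0 => hq (by rw [hqη, h0, mul_zero])
    rw [eq_div_of_mul_eq h2 (mul_left_cancel₀ hl h1).symm]
    exact div_mem (sum_mem fun i _ => mul_mem (huM i) (hηM i))
      (sum_mem fun i _ => pow_mem (hηM i) 2)
  intro i
  rw [← hM, ← div_mul_cancel₀ (ξ i) hl]
  exact mul_mem (hηM i) hlM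

end ProjDataLocus

end EDData

end

theorem mainTheorem8 (N : ℕ) :
    (∀ X Z : Set (Fin (N + 1) → ℂ),
      EDData.IsIrreducibleVariety X → EDData.IsIrreducibleVariety Z → Z ⊆ X →
      ∀ δ : ℕ, EDData.dim Z + (δ : WithBot ℕ∞) = EDData.dim X →
      EDData.IsEDRegular X Z →
        EDData.IsIrreducibleVariety (EDData.dataLocus X Z) ∧
        EDData.dim (EDData.dataLocus X Z) + (δ : WithBot ℕ∞) = ((N + 1 : ℕ) : WithBot ℕ∞) ∧
        ∀ c : ℕ, EDData.dim X + (c : WithBot ℕ∞) = ((N + 1 : ℕ) : WithBot ℕ∞) →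
          EDData.IsAffineBundleOver (EDData.smoothLocus X ∩ Z)
            (EDData.condEDCorrespondence X Z) c) ∧
    (∀ X Z : Set (Fin (N + 1) → ℂ),
      EDData.IsIrreducibleVariety X → EDData.IsIrreducibleVariety Z → Z ⊆ X →
      EDData.IsCone X → EDData.IsCone Z →
      ∀ n d : ℕ, EDData.dim X = ((n + 1 : ℕ) : WithBot ℕ∞) →
      EDData.dim Z = ((d + 1 : ℕ) : WithBot ℕ∞) →
      EDData.IsProjEDRegular X Z →
        EDData.IsIrreducibleVariety (EDData.dataLocus X Z) ∧
        EDData.dim (EDData.dataLocus X Z) + (n : WithBot ℕ∞) =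
          ((N + 1 + d : ℕ) : WithBot ℕ∞)) := by
  have hcard : ((Fintype.card (Fin (N + 1)) : ℕ) : WithBot ℕ∞) = ((N + 1 : ℕ) : WithBot ℕ∞) := by
    rw [Fintype.card_fin]
  refine ⟨fun X Z hX hZ hZX δ hδ hreg => ?_, fun X Z hX hZ hZX hXc _ n d hn hd hreg => ?_⟩
  · obtain ⟨c, hc⟩ := EDData.exists_codim hX
    refine ⟨EDData.isIrreducibleVariety_dataLocus hX hZ hZX hc hreg.1, ?_, fun r hr =>
      EDData.isAffineBundleOver_condEDCorrespondence hX hZ hZX (hr.trans hcard.symm)⟩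
    rw [EDData.dim_dataLocus_of_isEDRegular hX hZ hZX hc hreg, add_right_comm, hδ, hc, hcard]
  · obtain ⟨c, hc⟩ := EDData.exists_codim hX
    refine ⟨EDData.isIrreducibleVariety_dataLocus hX hZ hZX hc fun h =>
      hreg.1 (h.trans Set.subset_union_left), ?_⟩
    rw [EDData.dim_dataLocus_of_isProjEDRegular hX hZ hZX hXc hc hreg, hd]
    rw [hn, hcard] at hc
    norm_cast at hc ⊢
    omega
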